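/- Throughout, a \emph{curve} is a connected (Hausdorff) Riemann surface, compact or not, and a \emph{cover} is a nonconstant proper holomorphic map; its \emph{degree} is the number of points of a fibre over a point that is not a branch point. A cover is \emph{simply branched} if over each point of the target there is at most one ramification point, and its ramification index is $2$. For a cover $f\colon C\to D$ and a point $\star\in D^\circ:=D\setminus\{\text{branch points of } f\}$, the \emph{monodromy group} of $f$ (at $\star$) is the image of the monodromy map $\pi_1(D^\circ,\star)\to \mathrm{Sym}(f^{-1}(\star))$; $f$ has \emph{full monodromy} if this map is surjective. Let $f\colon C\to D$ be a simply branched cover of curves, factored as $C\xrightarrow{q}\overline{D}\xrightarrow{h}D$ with $q$ a cover with full monodromy and $h$ an unramified cover. Let $\tilde d=\deg q$ and $\bar d=\deg h$. Assume that $f$ has at least one branch point or that $\tilde d=1$. Let $\star\in D$ be a point that is not a branch point of $f$, and let $G\subset\mathrm{Sym}(f^{-1}(\star))$ and $\overline{G}\subset\mathrm{Sym}(h^{-1}(\star))$ be the monodromy groups of $f$ and $h$ at $\star$. Then there is a surjective homomorphism $\psi\colon G\to\overline{G}$, compatible with the actions on the fibres, that is, $\psi(g)(q(x))=q(g(x))$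 for all $g\in G$ and $x\in f^{-1}(\star)$. Its kernel is as large as it can be: it consists of all permutations $\sigma$ of $f^{-1}(\star)$ with $q\circ\sigma=q$, and there is an exact sequence \[ 1\to \underbrace{S_{\tilde d}\times\cdots\times S_{\tilde d}}_{\bar d\text{ factors}}\to G\xrightarrow{\ \psi\ }\overline{G}\to 1 . \] -/

import Mathlib

open scoped Manifold ContDiff Topology

namespace CurveCover

noncomputable section

/-- The fibre of the restricted map over `y` is the fibre of the map itself. -/
def fiberEquiv {X Y : Type*} (f : X → Y) (s : Set Y) (y : s) :
    s.restrictPreimage f ⁻¹' {y} ≃ f ⁻¹' {(y : Y)} where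
  toFun x := ⟨x.1.1, congrArg Subtype.val x.2⟩
  invFun x := ⟨⟨x.1, by rw [Set.mem_preimage, show f x.1 = y from x.2]; exact y.2⟩,
    Subtype.ext x.2⟩
  left_inv _ := rfl
  right_inv _ := rfl

section Basic

variable {X Y : Type*} [TopologicalSpace X] [ChartedSpace ℂ X] [TopologicalSpace Y]
  [ChartedSpace ℂ Y]

/-- A (finite) cover of Riemann surfaces: a nonconstant proper holomorphic map. -/
structure IsCover (f : X → Y) : Prop where
  holomorphic : MDifferentiable 𝓘(ℂ) 𝓘(ℂ) f
  proper : IsProperMap f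
  nonconstant : ¬ ∃ y, ∀ x, f x = y

/-- The ramification index (local degree) of a holomorphic map `f` at `x`: the order of vanishing
at `x` of `f - f x`, computed in the preferred charts at `x` and `f x`. -/
def ramificationIndex (f : X → Y) (x : X) : ℕ∞ :=
  analyticOrderAt
    (fun z => writtenInExtChartAt 𝓘(ℂ) 𝓘(ℂ) x f z -
      writtenInExtChartAt 𝓘(ℂ) 𝓘(ℂ) x f (extChartAt 𝓘(ℂ) x x))
    (extChartAt 𝓘(ℂ) x x)

/-- The map `f` is unramified: all its ramification indices are one. -/
def IsUnramified (f : X → Y) : Prop := ∀ x, ramificationIndex f x = 1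

/-- The set of branch points of `f`: the images of the ramification points. -/
def branchLocus (f : X → Y) : Set Y := f '' {x | ramificationIndex f x ≠ 1}

/-- A simply branched cover: ramification indices are at most two, and there is at most one
ramification point over each point of the target. -/
structure IsSimplyBranched (f : X → Y) : Prop extends IsCover f where
  index_le_two : ∀ x, ramificationIndex f x ≤ 2
  unique_ramification : ∀ x x', f x = f x' → ramificationIndex f x ≠ 1 →
    ramificationIndex f x' ≠ 1 → x = x'

/-- The degree of a cover: the number of points in any fibre over a point that is not a branch
point. (This number does not depend on the fibre, so the set below is a singleton.) -/
def degree (f : X → Y) : ℕ := sSup {n | ∃ y ∉ branchLocus f, n = (f ⁻¹' {y}).ncard}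

theorem IsUnramified.mem_compl_branchLocus {f : X → Y} (hf : IsUnramified f) (y : Y) :
    y ∈ (branchLocus f)ᶜ := by
  rintro ⟨x, hx, -⟩
  exact hx (hf x)

end Basic

section Monodromy

variable {X Y : Type*} [TopologicalSpace X] [ChartedSpace ℂ X] [IsManifold 𝓘(ℂ) ω X]
  [TopologicalSpace Y] [ChartedSpace ℂ Y] [IsManifold 𝓘(ℂ) ω Y]

/-- Near a point of ramification index one, a holomorphic map is a local homeomorphism. -/
theorem exists_openPartialHomeomorph {f : X → Y} (hf : MDifferentiable 𝓘(ℂ) 𝓘(ℂ) f) {x : X}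
    (hx : ramificationIndex f x = 1) :
    ∃ φ : OpenPartialHomeomorph X Y, x ∈ φ.source ∧ Set.EqOn f φ φ.source := by
  have : IsManifold 𝓘(ℂ) 1 X := IsManifold.of_le (n := ω) le_top
  have : IsManifold 𝓘(ℂ) 1 Y := IsManifold.of_le (n := ω) le_top
  set F : ℂ → ℂ := writtenInExtChartAt 𝓘(ℂ) 𝓘(ℂ) x f with hF
  set c := chartAt ℂ x with hc
  set c' := chartAt ℂ (f x) with hc'
  have hFc : F = fun z => c' (f (c.symm z)) := by
    ext z; simp [hF, hc, hc', writtenInExtChartAt]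
  have hfc : Continuous f := hf.continuous
  -- the local expression is holomorphic near the base point
  have hdiff : ∀ᶠ z in 𝓝 (c x), DifferentiableAt ℂ F z := by
    have hopen : IsOpen (c.target ∩ c.symm ⁻¹' (f ⁻¹' c'.source)) :=
      c.isOpen_inter_preimage_symm (c'.open_source.preimage hfc)
    have hmem : c x ∈ c.target ∩ c.symm ⁻¹' (f ⁻¹' c'.source) := by
      simp [hc, hc']
    filter_upwards [hopen.mem_nhds hmem] with z hz
    have hzs : c.symm z ∈ (chartAt ℂ x).source := c.map_target hz.1
    have := (mdifferentiableAt_iff_of_mem_source (I := 𝓘(ℂ)) (I' := 𝓘(ℂ)) hzs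
      (show f (c.symm z) ∈ (chartAt ℂ (f x)).source from hz.2)).1 (hf (c.symm z))
    have h2 := this.2
    simp only [modelWithCornersSelf_coe, Set.range_id, differentiableWithinAt_univ] at h2
    have e1 : (extChartAt 𝓘(ℂ) x) (c.symm z) = z := by
      simpa using c.right_inv hz.1
    rw [e1] at h2
    exact h2
  have han : AnalyticAt ℂ F (c x) := by
    rw [Complex.analyticAt_iff_eventually_differentiableAt]
    exact hdiff
  have hx' : analyticOrderAt (F · - F (c x)) (c x) = 1 := by
    rw [ramificationIndex, ← hF] at hx
    simpa [hc] using hx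
  have hd : deriv F (c x) ≠ 0 := by
    have h1 := han.analyticOrderAt_deriv_add_one
    rw [hx'] at h1
    have h0 : analyticOrderAt (deriv F) (c x) = 0 := by
      cases h : analyticOrderAt (deriv F) (c x) with
      | top => rw [h] at h1; simp at h1
      | coe n =>
        rw [h] at h1
        have : n + 1 = 1 := by exact_mod_cast h1
        have : n = 0 := by lia
        simp [this]
    exact (han.deriv.analyticOrderAt_eq_zero).1 h0
  have hsd : HasStrictFDerivAt F
      ((ContinuousLinearEquiv.unitsEquivAut ℂ (Units.mk0 _ hd)) : ℂ →L[ℂ] ℂ) (c x) :=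
    (han.hasStrictDerivAt).hasStrictFDerivAt_equiv hd
  set ψ := hsd.toOpenPartialHomeomorph F with hψ
  have hψF : (ψ : ℂ → ℂ) = F := hsd.toOpenPartialHomeomorph_coe
  have hcx : c x ∈ ψ.source := hsd.mem_toOpenPartialHomeomorph_source
  -- transport back to the surfaces
  set φ := (c.trans ψ).trans c'.symm with hφ
  have hφo : IsOpen (f ⁻¹' c'.source) := c'.open_source.preimage hfc
  refine ⟨φ.restrOpen (f ⁻¹' c'.source) hφo, ?_, ?_⟩
  · have hxc : x ∈ c.source := mem_chart_source ℂ x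
    have hfx : f x ∈ c'.source := mem_chart_source ℂ (f x)
    have : F (c x) ∈ c'.target := by
      rw [hFc]; simp only [c.left_inv hxc]; exact c'.map_source hfx
    simp [hφ, hxc, hfx, hcx, hψF, this]
  · intro u hu
    have hu' : u ∈ φ.source ∩ f ⁻¹' c'.source := by simpa using hu
    obtain ⟨hu1, hu2⟩ := hu'
    have huc : u ∈ c.source := by
      simp only [hφ, OpenPartialHomeomorph.trans_source, Set.mem_inter_iff] at hu1
      exact hu1.1.1
    have : φ u = f u := by
      simp only [hφ, OpenPartialHomeomorph.coe_trans, Function.comp_apply, hψF, hFc,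
        c.left_inv huc]
      exact c'.left_inv hu2
    exact this.symm

variable [T2Space X]

/-- A cover restricts to a topological covering map over the complement of its branch points. -/
theorem IsCover.isCoveringMapOn {f : X → Y} (hf : IsCover f) :
    IsCoveringMapOn f (branchLocus f)ᶜ := by
  have key : ∀ x, f x ∈ (branchLocus f)ᶜ →
      ∃ φ : OpenPartialHomeomorph X Y, x ∈ φ.source ∧ Set.EqOn f φ φ.source := by
    intro x hx
    refine exists_openPartialHomeomorph hf.holomorphic ?_
    by_contra h
    exact hx ⟨x, h, rfl⟩
  refine hf.proper.isClosedMap.isCoveringMapOn_of_isLocalHomeomorphOn (fun y hy => ?_)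
    (IsLocalHomeomorphOn.mk f _ key)
  refine (hf.proper.isCompact_preimage isCompact_singleton).finite ?_
  refine isDiscrete_iff_forall_mem_exists_isOpen.mpr fun x hx => ?_
  have hxy : f x = y := hx
  obtain ⟨φ, hφ, he⟩ := key x (by rw [hxy]; exact hy)
  refine ⟨φ.source, φ.open_source, subset_antisymm (fun u hu => ?_) ?_⟩
  · refine φ.injOn hu.1 hφ ?_
    rw [← he hu.1, ← he hφ, hxy]
    exact hu.2
  · rintro _ rfl
    exact ⟨hφ, hx⟩

/-- The monodromy map `π₁(Y°, y) → Sym(f⁻¹(y))`, where `Y°` is the complement of the set of branch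
points of `f` and `y` is a base point in `Y°`. -/
def monodromy {f : X → Y} (hf : IsCover f) (y : ((branchLocus f)ᶜ : Set Y)) :
    FundamentalGroup ((branchLocus f)ᶜ : Set Y) y →* Equiv.Perm (f ⁻¹' {(y : Y)}) :=
  (fiberEquiv f _ y).permCongrHom.toMonoidHom.comp
    (hf.isCoveringMapOn.isCoveringMap_restrictPreimage.monodromyPerm y)

/-- The monodromy group of the cover `f` at the base point `y`. -/
def monodromyGroup {f : X → Y} (hf : IsCover f) (y : ((branchLocus f)ᶜ : Set Y)) :
    Subgroup (Equiv.Perm (f ⁻¹' {(y : Y)})) :=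
  (monodromy hf y).range

/-- Full monodromy: every permutation of an unbranched fibre is a monodromy permutation.
(As the complement of the branch points is path connected, the base point does not matter.) -/
def HasFullMonodromy {f : X → Y} (hf : IsCover f) : Prop :=
  ∀ y, Function.Surjective (monodromy hf y)

end Monodromy

end

end CurveCover

/-! Monodromy permutations are handled through endpoints of lifted paths, and a path on a surface
can be pushed off a closed discrete set within its homotopy class
(`exists_homotopic_path_avoiding`). A loop avoiding the branch points of `h ∘ q` lifts along `h ∘ q`
and along `h`, and `q` carries lifts of the first kind to lifts of the second. So each element of
`G` induces one of the monodromy group of `h`. Since `h` is unramified, every loop for `h` can be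
moved off the branch points of `h ∘ q`, whence `ψ` is surjective (`exists_hom_of_compatible`).

The kernel clearly consists of the elements of `G` preserving the fibres of `q`; the content is that
every such permutation lies in `G`. A small loop around a branch point acts as a transposition, and
the two points exchanged have the same image under `q`, because `h` is injective near the image of
the ramification point (`exists_swap_mem_monodromyGroup`). A path in the connected surface `Dbar`
carries one fibre of `q` to another, and full monodromy of `q` adds the 2-transitivity of the
symmetric group; so `G` moves any pair of distinct points in a fibre of `q` to any other such pair
(`exists_mem_monodromyGroup_pair`). Conjugation yields all transpositions inside fibres of `q`, and
these generate the product of symmetric groups (`mem_of_forall_fiber_eq`). If `q` has degree one,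
this product is trivial. -/

namespace CurveCover

open Set Filter unitInterval

/-! ### Moving paths off a closed discrete set -/

section Deletion

variable {X : Type*} [TopologicalSpace X]

/-- Every neighbourhood of a point of a topological surface contains an open disc. -/
theorem exists_isOpenEmbedding_complex [ChartedSpace ℂ X] (x : X) {W : Set X} (hW : W ∈ 𝓝 x) :
    ∃ e : ℂ → X, Topology.IsOpenEmbedding e ∧ e 0 = x ∧ range e ⊆ W := by
  set c := chartAt ℂ x
  have hx : c x ∈ c.target := mem_chart_target ℂ x
  have hc : c.symm (c x) = x := c.left_inv (mem_chart_source ℂ x)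
  have hn : c.target ∩ c.symm ⁻¹' W ∈ 𝓝 (c x) := by
    refine inter_mem (c.open_target.mem_nhds hx) ?_
    exact (c.continuousAt_symm hx).preimage_mem_nhds (by rwa [hc])
  obtain ⟨r, hr, hb⟩ := Metric.mem_nhds_iff.1 hn
  have hs : ((OpenPartialHomeomorph.univBall (c x) r).trans c.symm).source = univ := by
    ext z
    have : OpenPartialHomeomorph.univBall (c x) r z ∈ Metric.ball (c x) r := by
      rw [← OpenPartialHomeomorph.univBall_target (c x) hr]
      exact (OpenPartialHomeomorph.univBall (c x) r).map_source (by simp)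
    simpa using (hb this).1
  refine ⟨_, OpenPartialHomeomorph.isOpenEmbedding _ hs, by simpa using hc, ?_⟩
  rintro _ ⟨z, rfl⟩
  have : OpenPartialHomeomorph.univBall (c x) r z ∈ Metric.ball (c x) r := by
    rw [← OpenPartialHomeomorph.univBall_target (c x) hr]
    exact (OpenPartialHomeomorph.univBall (c x) r).map_source (by simp)
  exact (hb this).2

/-- A disc around `x` that is small enough meets `B` at most in its centre, and a plane minus at
most one point is still path connected. -/
theorem exists_isSimplyConnected_isPathConnected_diff [ChartedSpace ℂ X] {B : Set X}
    (hB : ∀ x, ∀ᶠ z in 𝓝[≠] x, z ∉ B) (x : X) {W : Set X} (hW : W ∈ 𝓝 x) :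
    ∃ U ⊆ W, IsOpen U ∧ x ∈ U ∧ IsSimplyConnected U ∧ IsPathConnected (U \ B) := by
  have hB' : {z | z ≠ x → z ∉ B} ∈ 𝓝 x := by
    have := hB x
    rwa [eventually_nhdsWithin_iff] at this
  obtain ⟨e, he, rfl, hr⟩ := exists_isOpenEmbedding_complex x (inter_mem hW hB')
  refine ⟨range e, fun z hz => (hr hz).1, he.isOpen_range, ⟨0, rfl⟩, ?_, ?_⟩
  · have : SimplyConnectedSpace ℂ := inferInstance
    exact (ContinuousMap.HomotopyEquiv.simplyConnectedSpace_iff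
      he.isEmbedding.toHomeomorph.toHomotopyEquiv).1 this
  · have h1 : range e \ B = e '' (e ⁻¹' B)ᶜ := by
      ext z
      constructor
      · rintro ⟨⟨w, rfl⟩, hw⟩
        exact ⟨w, hw, rfl⟩
      · rintro ⟨w, hw, rfl⟩
        exact ⟨⟨w, rfl⟩, hw⟩
    have h2 : (e ⁻¹' B).Countable := by
      refine (countable_singleton (0 : ℂ)).mono fun w hw => ?_
      by_contra h
      exact (hr ⟨w, rfl⟩).2 (fun h' => h (he.injective h')) hw
    rw [h1]
    refine (h2.isPathConnected_compl_of_one_lt_rank ?_).image he.continuous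
    rw [Complex.rank_real_complex]
    exact Nat.one_lt_ofNat

theorem homotopic_of_isSimplyConnected {U : Set X} (hU : IsSimplyConnected U) {x y : X}
    (p p' : Path x y) (hp : ∀ t, p t ∈ U) (hp' : ∀ t, p' t ∈ U) : p.Homotopic p' := by
  have : SimplyConnectedSpace U := hU.simplyConnectedSpace
  have hx : x ∈ U := by simpa using hp 0
  have hy : y ∈ U := by simpa using hp 1
  let P : Path (⟨x, hx⟩ : U) ⟨y, hy⟩ :=
    { toFun := fun t => ⟨p t, hp t⟩
      source' := Subtype.ext p.source
      target' := Subtype.ext p.target }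
  let P' : Path (⟨x, hx⟩ : U) ⟨y, hy⟩ :=
    { toFun := fun t => ⟨p' t, hp' t⟩
      source' := Subtype.ext p'.source
      target' := Subtype.ext p'.target }
  exact (SimplyConnectedSpace.paths_homotopic P P').map ⟨Subtype.val, continuous_subtype_val⟩

/-- A path in a surface between two points outside a closed discrete set is homotopic to a path
that avoids this set. -/
theorem exists_homotopic_path_avoiding [ChartedSpace ℂ X] {B : Set X}
    (hB : ∀ x, ∀ᶠ z in 𝓝[≠] x, z ∉ B) {a b : X} (γ : Path a b) (ha : a ∉ B) (hb : b ∉ B) :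
    ∃ δ : Path a b, (∀ t, δ t ∉ B) ∧ δ.Homotopic γ := by
  -- `P t`: the part of `γ` up to time `t`, prolonged by an arbitrarily short path `c`, can be moved
  -- off `B`. The prolongation is needed because `γ t` itself may lie in `B`. The set of such `t` is
  -- shown to be open and closed in the interval.
  let P : I → Prop := fun t => ∀ W ∈ 𝓝 (γ t), ∃ z, ∃ c : Path (γ t) z, (∀ s, c s ∈ W) ∧
    ∃ δ : Path (γ 0) z, (∀ s, δ s ∉ B) ∧ δ.Homotopic ((γ.subpath 0 t).trans c)
  have key : ∀ {U : Set X}, IsSimplyConnected U → IsPathConnected (U \ B) → IsOpen U →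
      ∀ s t, (∀ r, γ.subpath s t r ∈ U) → ∀ z, ∀ c : Path (γ t) z, (∀ r, c r ∈ U) → z ∉ B →
      P s → ∃ δ : Path (γ 0) z, (∀ s, δ s ∉ B) ∧ δ.Homotopic ((γ.subpath 0 t).trans c) := by
    intro U hU hUB hUo s t hst z c hc hz hs
    have hsU : γ s ∈ U := by simpa using hst 0
    have hzU : z ∈ U := by simpa using hc 1
    obtain ⟨z', c', hc', δ', hδ', hh⟩ := hs U (hUo.mem_nhds hsU)
    have hz' : z' ∉ B := by simpa using hδ' 1
    have hz'U : z' ∈ U := by simpa using hc' 1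
    have hJ := hUB.joinedIn z' ⟨hz'U, hz'⟩ z ⟨hzU, hz⟩
    set d := hJ.somePath
    have hd : ∀ r, d r ∈ U \ B := hJ.somePath_mem
    have mem_trans : ∀ {S : Set X} {x y w : X} (p : Path x y) (p' : Path y w),
        (∀ r, p r ∈ S) → (∀ r, p' r ∈ S) → ∀ r, p.trans p' r ∈ S := by
      intro S x y w p p' h h' r
      rw [Path.trans_apply]
      split_ifs
      exacts [h _, h' _]
    refine ⟨δ'.trans d, mem_trans (S := Bᶜ) _ _ hδ' fun r => (hd r).2, ?_⟩
    -- Both paths run from `γ s` to `z` inside the simply connected `U`; the left one consists of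
    -- the old prolongation and a path `d` in `U \ B`.
    have h1 : (c'.trans d).Homotopic ((γ.subpath s t).trans c) :=
      homotopic_of_isSimplyConnected hU _ _ (mem_trans _ _ hc' fun r => (hd r).1)
        (mem_trans _ _ hst hc)
    have h2 : ((γ.subpath 0 s).trans (γ.subpath s t)).Homotopic (γ.subpath 0 t) :=
      ⟨Path.Homotopy.subpathTransSubpath γ 0 s t⟩
    exact (hh.hcomp (.refl d)).trans <| Path.Homotopic.trans ⟨Path.Homotopy.transAssoc _ _ _⟩ <|
      ((Path.Homotopic.refl _).hcomp h1).trans <|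
      Path.Homotopic.trans ⟨(Path.Homotopy.transAssoc _ _ _).symm⟩ <| h2.hcomp (.refl c)
  have step : ∀ {U : Set X}, IsSimplyConnected U → IsPathConnected (U \ B) → IsOpen U →
      ∀ s t, (∀ r, γ.subpath s t r ∈ U) → P s → P t := by
    intro U hU hUB hUo s t hst hs W hW
    have htU : γ t ∈ U := by simpa using hst 1
    obtain ⟨V, hVW, hVo, htV, hV, hVB⟩ := exists_isSimplyConnected_isPathConnected_diff hB (γ t)
      (inter_mem hW (hUo.mem_nhds htU))
    obtain ⟨z, hzV, hz⟩ := hVB.nonempty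
    have hJ := hV.isPathConnected.joinedIn _ htV z hzV
    exact ⟨z, hJ.somePath, fun r => (hVW (hJ.somePath_mem r)).1,
      key hU hUB hUo s t hst z _ (fun r => (hVW (hJ.somePath_mem r)).2) hz hs⟩
  have hsub : ∀ t, ∀ U ∈ 𝓝 (γ t), ∀ᶠ s in 𝓝 t, ∀ r, γ.subpath s t r ∈ U := by
    intro t U hU
    have h1 : γ ⁻¹' U ∈ 𝓝 t := γ.continuous.continuousAt hU
    obtain ⟨ε, hε, hεU⟩ := Metric.mem_nhds_iff.1 h1
    filter_upwards [Metric.ball_mem_nhds t hε] with s hs r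
    have : γ.subpath s t r ∈ range (γ.subpath s t) := ⟨r, rfl⟩
    rw [Path.range_subpath] at this
    obtain ⟨u, hu, hu'⟩ := this
    rw [← hu']
    have hu2 : (u : ℝ) ∈ uIcc (s : ℝ) t := hu
    exact hεU ((Real.dist_right_le_of_mem_uIcc hu2).trans_lt hs)
  have hP0 : P 0 := by
    intro W hW
    refine ⟨γ 0, Path.refl _, fun _ => mem_of_mem_nhds hW, Path.refl _, fun _ => ?_, ?_⟩
    · simpa using ha
    · rw [Path.subpath_self, Path.refl_trans_refl]
  have hloc : IsLocallyConstant P := by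
    rw [IsLocallyConstant.iff_eventually_eq]
    intro t
    obtain ⟨U, -, hUo, htU, hU, hUB⟩ := exists_isSimplyConnected_isPathConnected_diff hB (γ t)
      univ_mem
    filter_upwards [hsub t U (hUo.mem_nhds htU)] with s hs
    refine propext ⟨step hU hUB hUo s t hs, step hU hUB hUo t s fun r => ?_⟩
    rw [← Path.symm_subpath]
    exact hs _
  have hP1 : P 1 := by
    rw [hloc.apply_eq_of_preconnectedSpace 1 0]
    exact hP0
  -- At time 1 the prolongation can be taken constant, because the endpoint is outside `B`.
  obtain ⟨U, -, hUo, hbU, hU, hUB⟩ := exists_isSimplyConnected_isPathConnected_diff hB (γ 1)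
    univ_mem
  obtain ⟨δ, hδ, hh⟩ := key hU hUB hUo 1 1 (fun r => by simpa using hbU) (γ 1) (Path.refl _)
    (fun _ => hbU) (by simpa using hb) hP1
  refine ⟨δ.cast γ.source.symm γ.target.symm, hδ, ?_⟩
  have h3 : δ.Homotopic (γ.subpath 0 1) := hh.trans ⟨Path.Homotopy.transRefl _⟩
  have h4 := h3.pathCast γ.source.symm γ.target.symm
  rw [Path.subpath_zero_one] at h4
  exact h4

theorem exists_path_avoiding [ChartedSpace ℂ X] [ConnectedSpace X] {B : Set X}
    (hB : ∀ x, ∀ᶠ z in 𝓝[≠] x, z ∉ B) {a b : X} (ha : a ∉ B) (hb : b ∉ B) :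
    ∃ δ : Path a b, ∀ t, δ t ∉ B := by
  have := ChartedSpace.locallyPathConnectedSpace ℂ X
  have : PathConnectedSpace X := pathConnectedSpace_iff_connectedSpace.2 inferInstance
  obtain ⟨δ, hδ, -⟩ := exists_homotopic_path_avoiding hB (PathConnectedSpace.somePath a b) ha hb
  exact ⟨δ, hδ⟩

end Deletion

end CurveCover

namespace CurveCover

open Set Filter

/-! ### Path lifting over the unbranched locus -/

section Lifting

variable {X Y : Type*} [TopologicalSpace X] [TopologicalSpace Y] {f : X → Y} {s : Set Y}

/-- A path contained in `s`, as a path in the subtype. -/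
def pathInSubtype {a b : Y} (γ : Path a b) (hγ : ∀ t, γ t ∈ s) (ha : a ∈ s) (hb : b ∈ s) :
    Path (⟨a, ha⟩ : s) ⟨b, hb⟩ where
  toFun t := ⟨γ t, hγ t⟩
  source' := Subtype.ext γ.source
  target' := Subtype.ext γ.target

theorem exists_lift_path (hf : IsCoveringMapOn f s) {a b : Y} (γ : Path a b) (hγ : ∀ t, γ t ∈ s)
    {x : X} (hx : f x = a) : ∃ x', ∃ Γ : Path x x', ∀ t, f (Γ t) = γ t := by
  have ha : a ∈ s := by simpa using hγ 0
  have hb : b ∈ s := by simpa using hγ 1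
  subst hx
  obtain ⟨Γ, h1, h2⟩ := hf.isCoveringMap_restrictPreimage.exists_path_lifts
    (pathInSubtype γ hγ ha hb : C(unitInterval, s)) ⟨x, ha⟩ (Path.source _)
  refine ⟨(Γ 1).1, ⟨⟨fun t => (Γ t).1, by fun_prop⟩, congrArg Subtype.val h2, rfl⟩, fun t => ?_⟩
  exact congrArg Subtype.val (congrFun h1 t)

theorem lift_path_unique (hf : IsCoveringMapOn f s) {a b : Y} (γ : Path a b)
    (hγ : ∀ t, γ t ∈ s) {x x' x'' : X} (Γ : Path x x') (Γ' : Path x x'')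
    (hΓ : ∀ t, f (Γ t) = γ t) (hΓ' : ∀ t, f (Γ' t) = γ t) : x' = x'' := by
  let G : unitInterval → f ⁻¹' s := fun t => ⟨Γ t, by rw [mem_preimage, hΓ]; exact hγ t⟩
  let G' : unitInterval → f ⁻¹' s := fun t => ⟨Γ' t, by rw [mem_preimage, hΓ']; exact hγ t⟩
  have : G = G' := hf.isCoveringMap_restrictPreimage.eq_of_comp_eq (g₁ := G) (g₂ := G')
    (by fun_prop) (by fun_prop) (funext fun t => Subtype.ext ((hΓ t).trans (hΓ' t).symm)) 0
    (Subtype.ext (Γ.source.trans Γ'.source.symm))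
  simpa [G, G'] using congrArg Subtype.val (congrFun this 1)

end Lifting

/-! ### Monodromy groups in terms of lifted loops -/

section Monodromy

variable {X Y : Type*} [TopologicalSpace X] [ChartedSpace ℂ X] [IsManifold 𝓘(ℂ) ω X]
  [TopologicalSpace Y] [ChartedSpace ℂ Y] [IsManifold 𝓘(ℂ) ω Y] [T2Space X] {f : X → Y}

theorem exists_lift_path_monodromy (hf : IsCover f) (y : ((branchLocus f)ᶜ : Set Y))
    (γ : Path y y) (x : f ⁻¹' {(y : Y)}) :
    ∃ Γ : Path (x : X) (monodromy hf y (Path.Homotopic.Quotient.mk γ) x),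
      ∀ t, f (Γ t) = γ t := by
  let cov := hf.isCoveringMapOn.isCoveringMap_restrictPreimage
  let e := (fiberEquiv f _ y).symm x
  have he : γ 0 = (branchLocus f)ᶜ.restrictPreimage f e.1 := γ.source.trans e.2.symm
  refine ⟨⟨⟨fun t => (cov.liftPath γ e.1 he t).1, by fun_prop⟩, ?_, rfl⟩, fun t => ?_⟩
  · exact congrArg Subtype.val (cov.liftPath_zero γ e.1 he)
  · exact congrArg Subtype.val (congrFun (cov.liftPath_lifts γ e.1 he) t)

/-- Every loop in the complement of the branch points has a monodromy permutation, given by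
lifting of paths. -/
theorem exists_mem_monodromyGroup (hf : IsCover f) {y : Y} (hy : y ∈ (branchLocus f)ᶜ)
    (γ : Path y y) (hγ : ∀ t, γ t ∉ branchLocus f) :
    ∃ σ ∈ monodromyGroup hf ⟨y, hy⟩, ∀ x : f ⁻¹' {y},
      ∃ Γ : Path (x : X) (σ x), ∀ t, f (Γ t) = γ t :=
  ⟨_, ⟨Path.Homotopic.Quotient.mk (pathInSubtype γ hγ hy hy), rfl⟩,
    fun x => exists_lift_path_monodromy hf ⟨y, hy⟩ (pathInSubtype γ hγ hy hy) x⟩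

/-- Every monodromy permutation is given by lifting of a loop in the complement of the branch
points, which moreover can be chosen to avoid a given closed discrete set. -/
theorem exists_loop_of_mem_monodromyGroup (hf : IsCover f) (hfc : IsClosed (branchLocus f))
    {B : Set Y} (hB : ∀ x, ∀ᶠ z in 𝓝[≠] x, z ∉ B) {y : Y} (hy : y ∈ (branchLocus f)ᶜ)
    (hyB : y ∉ B) {σ : Equiv.Perm (f ⁻¹' {y})} (hσ : σ ∈ monodromyGroup hf ⟨y, hy⟩) :
    ∃ γ : Path y y, (∀ t, γ t ∉ branchLocus f) ∧ (∀ t, γ t ∉ B) ∧ ∀ x : f ⁻¹' {y},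
      ∃ Γ : Path (x : X) (σ x), ∀ t, f (Γ t) = γ t := by
  obtain ⟨g, rfl⟩ := hσ
  obtain ⟨γ, rfl⟩ := Path.Homotopic.Quotient.mk_surjective g
  -- The loop is moved inside the open surface of unbranched points, so that the homotopy also
  -- avoids the branch points and the monodromy permutation does not change.
  let : ChartedSpace ℂ ((branchLocus f)ᶜ : Set Y) :=
    inferInstanceAs (ChartedSpace ℂ (⟨_, hfc.isOpen_compl⟩ : TopologicalSpace.Opens Y))
  have hB' : ∀ x : ((branchLocus f)ᶜ : Set Y), ∀ᶠ z in 𝓝[≠] x, z ∉ Subtype.val ⁻¹' B := by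
    intro x
    have h1 : Tendsto (Subtype.val : ((branchLocus f)ᶜ : Set Y) → Y) (𝓝[≠] x) (𝓝[≠] x.1) :=
      continuous_subtype_val.continuousAt.continuousWithinAt.tendsto_nhdsWithin
        fun z hz h => hz (Subtype.ext h)
    exact h1.eventually (hB x)
  obtain ⟨δ, hδ, hh⟩ := exists_homotopic_path_avoiding hB' γ hyB hyB
  refine ⟨δ.map continuous_subtype_val, fun t => (δ t).2, hδ, fun x => ?_⟩
  rw [← (Path.Homotopic.Quotient.eq).2 hh]
  exact exists_lift_path_monodromy hf _ δ x

theorem mem_monodromyGroup_of_loop (hf : IsCover f) {y : Y} (hy : y ∈ (branchLocus f)ᶜ)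
    (γ : Path y y) (hγ : ∀ t, γ t ∉ branchLocus f) {σ : Equiv.Perm (f ⁻¹' {y})}
    (hσ : ∀ x : f ⁻¹' {y}, ∃ Γ : Path (x : X) (σ x), ∀ t, f (Γ t) = γ t) :
    σ ∈ monodromyGroup hf ⟨y, hy⟩ := by
  obtain ⟨τ, hτ, h⟩ := exists_mem_monodromyGroup hf hy γ hγ
  convert hτ
  ext x
  obtain ⟨Γ, hΓ⟩ := hσ x
  obtain ⟨Γ', hΓ'⟩ := h x
  exact lift_path_unique hf.isCoveringMapOn γ hγ Γ Γ' hΓ hΓ'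

/-- The number of points in the fibres over the points that are not branch points is constant. -/
theorem ncard_fiber_eq_of_path (hf : IsCover f) {a b : Y} (γ : Path a b)
    (hγ : ∀ t, γ t ∉ branchLocus f) : (f ⁻¹' {a}).ncard = (f ⁻¹' {b}).ncard := by
  have hc := hf.isCoveringMapOn
  choose! φ Γ hΓ using fun (x : X) (hx : f x = a) => exists_lift_path hc γ hγ hx
  refine Set.ncard_congr (fun x _ => φ x) ?_ ?_ ?_
  · intro x hx
    simpa using hΓ x hx 1
  · intro x x' hx hx' h
    -- Injectivity: two lifts with the same endpoint are lifts of the reversed path with the same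
    -- starting point.
    refine lift_path_unique hc γ.symm (fun t => hγ _) (Γ x hx).symm ((Γ x' hx').symm.cast h rfl)
      (fun t => hΓ x hx _) fun t => hΓ x' hx' _
  · intro z hz
    obtain ⟨x, Δ, hΔ⟩ := exists_lift_path hc γ.symm (fun t => hγ _) hz
    have hx : f x = a := by simpa using hΔ 1
    refine ⟨x, hx, lift_path_unique hc γ hγ (Γ x hx) Δ.symm (hΓ x hx) fun t => ?_⟩
    simpa using hΔ (unitInterval.symm t)

theorem degree_eq_ncard_fiber [ConnectedSpace Y] (hf : IsCover f)
    (hB : ∀ x, ∀ᶠ z in 𝓝[≠] x, z ∉ branchLocus f) {y : Y} (hy : y ∉ branchLocus f) :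
    degree f = (f ⁻¹' {y}).ncard := by
  have : {n | ∃ y ∉ branchLocus f, n = (f ⁻¹' {y}).ncard} = {(f ⁻¹' {y}).ncard} := by
    ext n
    simp only [mem_ofPred_eq, mem_singleton_iff]
    constructor
    · rintro ⟨z, hz, rfl⟩
      obtain ⟨γ, hγ⟩ := exists_path_avoiding hB hz hy
      exact ncard_fiber_eq_of_path hf γ hγ
    · rintro rfl
      exact ⟨y, hy, rfl⟩
  rw [degree, this, csSup_singleton]

theorem finite_fiber (hf : IsCover f) {y : Y} (hy : y ∉ branchLocus f) : (f ⁻¹' {y}).Finite := by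
  have := (hf.isCoveringMapOn y hy).1
  exact (hf.proper.isCompact_preimage isCompact_singleton).finite (isDiscrete_iff_discreteTopology.2 this)

end Monodromy

end CurveCover

namespace CurveCover

open Set Filter

/-- The hypothesis `hB` says that `B` has no accumulation point in `X`; it is the form in which
"closed and discrete" is used throughout. -/
theorem isClosed_of_eventually_notMem {X : Type*} [TopologicalSpace X] {B : Set X}
    (hB : ∀ x, ∀ᶠ z in 𝓝[≠] x, z ∉ B) : IsClosed B := by
  rw [← isOpen_compl_iff, isOpen_iff_mem_nhds]
  intro x hx
  filter_upwards [eventually_nhdsWithin_iff.1 (hB x)] with z hz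
  by_cases h : z = x
  · rwa [h]
  · exact hz h

/-! ### Local behaviour of holomorphic maps -/

section LocalAnalysis

variable {X Y : Type*} [TopologicalSpace X] [ChartedSpace ℂ X] [IsManifold 𝓘(ℂ) ω X]
  [TopologicalSpace Y] [ChartedSpace ℂ Y] [IsManifold 𝓘(ℂ) ω Y] {f : X → Y}

/-- The expression of a map between Riemann surfaces in the preferred charts at `x` and `f x`. -/
noncomputable def localExpr (f : X → Y) (x : X) : ℂ → ℂ :=
  fun z => chartAt ℂ (f x) (f ((chartAt ℂ x).symm z))

omit [IsManifold 𝓘(ℂ) ω X] [IsManifold 𝓘(ℂ) ω Y] in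
theorem ramificationIndex_eq (f : X → Y) (x : X) : ramificationIndex f x =
    analyticOrderAt (fun z => localExpr f x z - localExpr f x (chartAt ℂ x x)) (chartAt ℂ x x) := by
  simp [ramificationIndex, writtenInExtChartAt, localExpr, Function.comp_def]

theorem analyticAt_localExpr (hf : MDifferentiable 𝓘(ℂ) 𝓘(ℂ) f) (x : X) :
    AnalyticAt ℂ (localExpr f x) (chartAt ℂ x x) := by
  have : IsManifold 𝓘(ℂ) 1 X := IsManifold.of_le (n := ω) le_top
  have : IsManifold 𝓘(ℂ) 1 Y := IsManifold.of_le (n := ω) le_top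
  rw [Complex.analyticAt_iff_eventually_differentiableAt]
  have hopen := (chartAt ℂ x).isOpen_inter_preimage_symm
    ((chartAt ℂ (f x)).open_source.preimage hf.continuous)
  filter_upwards [hopen.mem_nhds (show chartAt ℂ x x ∈ _ by simp)] with z hz
  have h2 := ((mdifferentiableAt_iff_of_mem_source (I := 𝓘(ℂ)) (I' := 𝓘(ℂ))
    ((chartAt ℂ x).map_target hz.1) (show f ((chartAt ℂ x).symm z) ∈ (chartAt ℂ (f x)).source from
      hz.2)).1 (hf _)).2
  simp only [modelWithCornersSelf_coe, Set.range_id, differentiableWithinAt_univ] at h2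
  rw [show (extChartAt 𝓘(ℂ) x) ((chartAt ℂ x).symm z) = z by
    simpa using (chartAt ℂ x).right_inv hz.1] at h2
  exact h2

theorem analyticOrderAt_deriv_localExpr (hf : MDifferentiable 𝓘(ℂ) 𝓘(ℂ) f) (x : X) :
    analyticOrderAt (deriv (localExpr f x)) (chartAt ℂ x x) + 1 = ramificationIndex f x := by
  rw [ramificationIndex_eq, (analyticAt_localExpr hf x).analyticOrderAt_deriv_add_one]

/-- The manifold derivative does not depend on the preferred charts and obeys the chain rule. This
criterion thus serves both for comparing charts at nearby points and for composed maps. -/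
theorem ramificationIndex_eq_one_iff (hf : MDifferentiable 𝓘(ℂ) 𝓘(ℂ) f) (x : X) :
    ramificationIndex f x = 1 ↔ mfderiv 𝓘(ℂ) 𝓘(ℂ) f x ≠ 0 := by
  have h1 : mfderiv 𝓘(ℂ) 𝓘(ℂ) f x = fderiv ℂ (localExpr f x) (chartAt ℂ x x) := by
    rw [(hf x).mfderiv]
    simp only [modelWithCornersSelf_coe, Set.range_id, fderivWithin_univ]
    rfl
  have h2 : mfderiv 𝓘(ℂ) 𝓘(ℂ) f x ≠ 0 ↔ deriv (localExpr f x) (chartAt ℂ x x) ≠ 0 := by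
    rw [h1, not_iff_not]
    constructor
    · intro h
      rw [← fderiv_apply_one_eq_deriv]
      exact congrArg (fun L : ℂ →L[ℂ] ℂ => L 1) h
    · intro h
      refine ContinuousLinearMap.ext_ring ?_
      exact (fderiv_apply_one_eq_deriv).trans h
  rw [h2, ← analyticOrderAt_deriv_localExpr hf x,
    ← (analyticAt_localExpr hf x).deriv.analyticOrderAt_eq_zero]
  cases analyticOrderAt (deriv (localExpr f x)) (chartAt ℂ x x) with
  | top => simp
  | coe n => norm_cast; simp

theorem ramificationIndex_ne_zero (hf : MDifferentiable 𝓘(ℂ) 𝓘(ℂ) f) (x : X) :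
    ramificationIndex f x ≠ 0 := by
  rw [← analyticOrderAt_deriv_localExpr hf x]
  simp

theorem ramificationIndex_eq_one_of_deriv_ne_zero (hf : MDifferentiable 𝓘(ℂ) 𝓘(ℂ) f) {x z : X}
    (hz : z ∈ (chartAt ℂ x).source) (hfz : f z ∈ (chartAt ℂ (f x)).source)
    (h : deriv (localExpr f x) (chartAt ℂ x z) ≠ 0) : ramificationIndex f z = 1 := by
  have : IsManifold 𝓘(ℂ) 1 X := IsManifold.of_le (n := ω) le_top
  have : IsManifold 𝓘(ℂ) 1 Y := IsManifold.of_le (n := ω) le_top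
  rw [ramificationIndex_eq_one_iff hf]
  intro h0
  apply h
  have hzz : (chartAt ℂ x).symm (chartAt ℂ x z) = z := (chartAt ℂ x).left_inv hz
  have h1 : MDifferentiableAt 𝓘(ℂ) 𝓘(ℂ) (chartAt ℂ x).symm (chartAt ℂ x z) :=
    mdifferentiableAt_atlas_symm (chart_mem_atlas ℂ x) ((chartAt ℂ x).map_source hz)
  have h2 : MDifferentiableAt 𝓘(ℂ) 𝓘(ℂ) (chartAt ℂ (f x)) (f z) :=
    mdifferentiableAt_atlas (chart_mem_atlas ℂ (f x)) hfz
  have h3 : mfderiv 𝓘(ℂ) 𝓘(ℂ) ((chartAt ℂ (f x)) ∘ f) z = 0 := by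
    rw [mfderiv_comp z h2 (hf z), h0, ContinuousLinearMap.comp_zero]
  have h4 : mfderiv 𝓘(ℂ) 𝓘(ℂ) (localExpr f x) (chartAt ℂ x z) = 0 := by
    have := mfderiv_comp_of_eq (I := 𝓘(ℂ)) (I' := 𝓘(ℂ)) (I'' := 𝓘(ℂ)) (h2.comp z (hf z)) h1 hzz
    rw [hzz, h3] at this
    exact this.trans (ContinuousLinearMap.zero_comp _)
  rw [mfderiv_eq_fderiv] at h4
  rw [← fderiv_apply_one_eq_deriv]
  exact congrArg (fun L : ℂ →L[ℂ] ℂ => L 1) h4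

/-- Ramification points are zeros of the derivative in charts, and the zeros of an analytic function
that is not locally zero are isolated. Index `⊤` is the locally constant case. -/
theorem eventually_ramificationIndex_eq_one (hf : MDifferentiable 𝓘(ℂ) 𝓘(ℂ) f) {x : X}
    (hx : ramificationIndex f x ≠ ⊤) : ∀ᶠ z in 𝓝[≠] x, ramificationIndex f z = 1 := by
  have hd := (analyticAt_localExpr hf x).deriv
  have h1 : ∀ᶠ w in 𝓝[≠] (chartAt ℂ x x), deriv (localExpr f x) w ≠ 0 := by
    refine hd.eventually_eq_zero_or_eventually_ne_zero.resolve_left fun h => hx ?_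
    rw [← analyticOrderAt_deriv_localExpr hf x, analyticOrderAt_eq_top.2 h]
    simp
  have hs := (chartAt ℂ x).open_source.mem_nhds (mem_chart_source ℂ x)
  have ht : f ⁻¹' (chartAt ℂ (f x)).source ∈ 𝓝 x :=
    hf.continuous.continuousAt ((chartAt ℂ (f x)).open_source.mem_nhds (mem_chart_source ℂ (f x)))
  rw [eventually_nhdsWithin_iff] at h1 ⊢
  filter_upwards [hs, ht,
    ((chartAt ℂ x).continuousAt (mem_chart_source ℂ x)).eventually h1] with z hz hz' hz2 hne
  refine ramificationIndex_eq_one_of_deriv_ne_zero hf hz hz' (hz2 fun h => hne ?_)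
  exact (chartAt ℂ x).injOn hz (mem_chart_source ℂ x) h

/-- The open mapping theorem for analytic functions, transported through the charts. -/
theorem nhds_le_map_nhds (hf : MDifferentiable 𝓘(ℂ) 𝓘(ℂ) f) {x : X}
    (hx : ramificationIndex f x ≠ ⊤) : 𝓝 (f x) ≤ map f (𝓝 x) := by
  set c := chartAt ℂ x
  set c' := chartAt ℂ (f x)
  have hxs : x ∈ c.source := mem_chart_source ℂ x
  have hfx : f x ∈ c'.source := mem_chart_source ℂ (f x)
  have h1 : 𝓝 (localExpr f x (c x)) ≤ map (localExpr f x) (𝓝 (c x)) := by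
    refine (analyticAt_localExpr hf x).eventually_constant_or_nhds_le_map_nhds.resolve_left
      fun h => hx ?_
    rw [ramificationIndex_eq, analyticOrderAt_eq_top]
    filter_upwards [h] with z hz
    rw [hz, sub_self]
  have h2 : localExpr f x (c x) = c' (f x) := by
    simp [localExpr, c, c']
  have h3 : map c (𝓝 x) = 𝓝 (c x) := c.map_nhds_eq hxs
  rw [← h3, map_map, h2, ← c'.map_nhds_eq hfx] at h1
  have h4 : map (localExpr f x ∘ c) (𝓝 x) = map (c' ∘ f) (𝓝 x) := by
    refine Filter.map_congr ?_
    filter_upwards [c.open_source.mem_nhds hxs] with z hz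
    simp [localExpr, c, c', (chartAt ℂ x).left_inv hz]
  rw [h4, ← map_map] at h1
  have h5 := map_mono (m := c'.symm) h1
  have h6 : ∀ l : Filter Y, l ≤ 𝓝 (f x) → map c'.symm (map c' l) = l := by
    intro l hl
    rw [map_map]
    conv_rhs => rw [← map_id (f := l)]
    refine Filter.map_congr ?_
    filter_upwards [hl (c'.open_source.mem_nhds hfx)] with z hz
    exact c'.left_inv hz
  rwa [h6 _ le_rfl, h6 _ hf.continuous.continuousAt] at h5

/-- At a point of ramification index two, a holomorphic map is the square of a local coordinate. -/
theorem exists_coordinate_sq (hf : MDifferentiable 𝓘(ℂ) 𝓘(ℂ) f) {x : X}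
    (hx : ramificationIndex f x = 2) :
    ∃ u : OpenPartialHomeomorph X ℂ, x ∈ u.source ∧ u x = 0 ∧
      ∀ z ∈ u.source, f z ∈ (chartAt ℂ (f x)).source ∧
        chartAt ℂ (f x) (f z) = chartAt ℂ (f x) (f x) + u z ^ 2 := by
  set c := chartAt ℂ x
  set c' := chartAt ℂ (f x)
  have hxs : x ∈ c.source := mem_chart_source ℂ x
  have hfx : f x ∈ c'.source := mem_chart_source ℂ (f x)
  have han := analyticAt_localExpr hf x
  rw [ramificationIndex_eq] at hx
  have han' : AnalyticAt ℂ (fun z => localExpr f x z - localExpr f x (c x)) (c x) := by fun_prop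
  obtain ⟨g, hg, hg0, hgF⟩ := (han'.analyticOrderAt_eq_natCast (n := 2)).1 hx
  -- a square root of `g`
  let k : ℂ → ℂ := fun z => g (c x) ^ (1 / 2 : ℂ) * (g z / g (c x)) ^ (1 / 2 : ℂ)
  have hk : AnalyticAt ℂ k (c x) := by
    -- Division by `g (c x)` moves the base value to 1, where the principal branch of the square
    -- root is analytic.
    refine analyticAt_const.mul (AnalyticAt.cpow (hg.div analyticAt_const hg0) analyticAt_const ?_)
    rw [div_self hg0]
    exact Complex.one_mem_slitPlane
  have hk2 : ∀ z, k z ^ 2 = g z := by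
    intro z
    have h2 : ∀ w : ℂ, (w ^ (1 / 2 : ℂ)) ^ 2 = w := by
      intro w
      simp
    simp only [k]
    rw [mul_pow, h2, h2, mul_div_cancel₀ _ hg0]
  have hk0 : k (c x) ≠ 0 := fun h => hg0 (by rw [← hk2, h]; simp)
  -- The square of `v` is the local expression minus its value at the base point, and `v` has
  -- nonzero derivative `k (c x)` there, so it is a coordinate.
  let v : ℂ → ℂ := fun z => (z - c x) * k z
  have hv : AnalyticAt ℂ v (c x) := (analyticAt_id.sub analyticAt_const).mul hk
  have hvd : deriv v (c x) = k (c x) := by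
    have h1 : HasDerivAt (fun z => z - c x) 1 (c x) := (hasDerivAt_id _).sub_const _
    have := (h1.mul hk.differentiableAt.hasDerivAt).deriv
    simpa [v, Pi.mul_def] using this
  have hvs : HasStrictFDerivAt v ((ContinuousLinearEquiv.unitsEquivAut ℂ
      (Units.mk0 _ (hvd ▸ hk0 : deriv v (c x) ≠ 0))) : ℂ →L[ℂ] ℂ) (c x) :=
    hv.hasStrictDerivAt.hasStrictFDerivAt_equiv _
  set ψ := hvs.toOpenPartialHomeomorph v
  have hψv : (ψ : ℂ → ℂ) = v := hvs.toOpenPartialHomeomorph_coe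
  have hcx : c x ∈ ψ.source := hvs.mem_toOpenPartialHomeomorph_source
  obtain ⟨O, hOs, hO, hcxO⟩ := eventually_nhds_iff.1 hgF
  have hN : IsOpen (c.source ∩ c ⁻¹' O ∩ f ⁻¹' c'.source) :=
    (c.isOpen_inter_preimage hO).inter (c'.open_source.preimage hf.continuous)
  refine ⟨(c.trans ψ).restrOpen _ hN, ?_, ?_, ?_⟩
  · simp [hxs, hcx, hcxO, hfx]
  · simp [hψv, v]
  · intro z hz
    have hz' : z ∈ (c.trans ψ).source ∩ (c.source ∩ c ⁻¹' O ∩ f ⁻¹' c'.source) := by simpa using hz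
    refine ⟨hz'.2.2, ?_⟩
    have h3 := hOs _ hz'.2.1.2
    simp only [localExpr] at h3
    rw [show (chartAt ℂ x).symm (c z) = z from c.left_inv hz'.2.1.1,
      show (chartAt ℂ x).symm (c x) = x from c.left_inv hxs] at h3
    have h4 : (c.trans ψ).restrOpen _ hN z = (c z - c x) * k (c z) := by
      simp [hψv, v]
    rw [h4, mul_pow, hk2, ← sub_eq_iff_eq_add']
    simpa using h3

end LocalAnalysis

/-! ### Discreteness of the branch locus and surjectivity -/

section Branch

variable {X Y : Type*} [TopologicalSpace X] [ChartedSpace ℂ X] [IsManifold 𝓘(ℂ) ω X]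
  [TopologicalSpace Y] [ChartedSpace ℂ Y] [IsManifold 𝓘(ℂ) ω Y] {f : X → Y}

/-- The branch points of a cover form a closed discrete set. -/
theorem eventually_notMem_branchLocus (hf : IsCover f) (hr : ∀ x, ramificationIndex f x ≠ ⊤)
    (y : Y) : ∀ᶠ z in 𝓝[≠] y, z ∉ branchLocus f := by
  -- Ramification points accumulate nowhere, so those outside the fibre of `y` form a closed set.
  -- Its image under the proper map `f` is closed and misses `y`.
  have hR : IsClosed {x | ramificationIndex f x ≠ 1 ∧ f x ≠ y} := by
    refine isClosed_of_eventually_notMem fun x => ?_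
    filter_upwards [eventually_ramificationIndex_eq_one hf.holomorphic (hr x)] with z hz h
    exact h.1 hz
  have hy : y ∈ (f '' {x | ramificationIndex f x ≠ 1 ∧ f x ≠ y})ᶜ := by
    rintro ⟨x, hx, h⟩
    exact hx.2 h
  rw [eventually_nhdsWithin_iff]
  filter_upwards [(hf.proper.isClosedMap _ hR).isOpen_compl.mem_nhds hy] with z hz hne
  rintro ⟨x, hx, rfl⟩
  exact hz ⟨x, ⟨hx, hne⟩, rfl⟩

omit [IsManifold 𝓘(ℂ) ω X] [IsManifold 𝓘(ℂ) ω Y] in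
theorem IsCover.surjective [ConnectedSpace Y] [Nonempty X] (hf : IsCover f)
    (hr : ∀ x, 𝓝 (f x) ≤ map f (𝓝 x)) : Function.Surjective f := by
  have h1 : IsClopen (range f) := by
    refine ⟨hf.proper.isClosedMap.isClosed_range, isOpen_iff_mem_nhds.2 ?_⟩
    rintro _ ⟨x, rfl⟩
    exact hr x range_mem_map
  exact range_eq_univ.1 (h1.eq_univ (range_nonempty f))

end Branch

end CurveCover

namespace CurveCover

/-! ### Permutations compatible with a map of finite sets -/

section FiberedPermutations

variable {Ω Λ : Type*} {π : Ω → Λ} {G : Subgroup (Equiv.Perm Ω)} {H : Subgroup (Equiv.Perm Λ)}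

/-- A permutation group that contains a transposition inside a fibre and acts transitively on the
pairs of distinct points in a common fibre contains all permutations that preserve the fibres. -/
theorem mem_of_forall_fiber_eq [Finite Ω] [DecidableEq Ω] {a a' : Ω} (hG : Equiv.swap a a' ∈ G)
    (htrans : ∀ b b', b ≠ b' → π b = π b' → ∃ g ∈ G, g a = b ∧ g a' = b')
    {σ : Equiv.Perm Ω} (hσ : ∀ x, π (σ x) = π x) : σ ∈ G := by
  have hswap : ∀ b b', b ≠ b' → π b = π b' → Equiv.swap b b' ∈ G := by
    intro b b' hne hb
    obtain ⟨g, hg, rfl, rfl⟩ := htrans b b' hne hb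
    rw [Equiv.swap_apply_apply]
    exact G.mul_mem (G.mul_mem hg hG) (G.inv_mem hg)
  let S : Set (Equiv.Perm Ω) := {τ | ∃ b b', b ≠ b' ∧ π b = π b' ∧ τ = Equiv.swap b b'}
  have hS : ∀ τ ∈ S, τ.IsSwap := by
    rintro _ ⟨b, b', hne, -, rfl⟩
    exact ⟨b, b', hne, rfl⟩
  have hle : Subgroup.closure S ≤ G := by
    rw [Subgroup.closure_le]
    rintro _ ⟨b, b', hne, hb, rfl⟩
    exact hswap b b' hne hb
  -- A finitely supported permutation lies in a group generated by swaps as soon as it keeps every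
  -- point in its orbit; here one swap joins `x` to `σ x`.
  refine hle ((mem_closure_isSwap hS).2 ⟨Set.toFinite _, fun x => ?_⟩)
  by_cases hx : σ x = x
  · rw [hx]
    exact MulAction.mem_orbit_self x
  · exact ⟨⟨Equiv.swap x (σ x), Subgroup.subset_closure ⟨x, σ x, Ne.symm hx, (hσ x).symm, rfl⟩⟩,
      Equiv.swap_apply_left x (σ x)⟩

/-- As `π` is surjective, the permutation of `Λ` induced by `σ` is unique, so an arbitrary choice of
it is automatically multiplicative. -/
theorem exists_hom_of_compatible (hπ : Function.Surjective π)
    (h1 : ∀ σ ∈ G, ∃ τ ∈ H, ∀ x, τ (π x) = π (σ x))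
    (h2 : ∀ τ ∈ H, ∃ σ ∈ G, ∀ x, τ (π x) = π (σ x)) :
    ∃ ψ : G →* H, Function.Surjective ψ ∧
      ∀ g x, (ψ g : Equiv.Perm Λ) (π x) = π ((g : Equiv.Perm Ω) x) := by
  choose! φ hφ hφπ using h1
  have uniq : ∀ τ τ' : Equiv.Perm Λ, (∀ x, τ (π x) = τ' (π x)) → τ = τ' := by
    intro τ τ' h
    ext l
    obtain ⟨x, rfl⟩ := hπ l
    exact h x
  refine ⟨MonoidHom.mk' (fun g => ⟨φ g, hφ g g.2⟩) fun g g' => Subtype.ext (uniq _ _ fun x => ?_),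
    fun τ => ?_, fun g x => hφπ g g.2 x⟩
  · simp only [Subgroup.coe_mul, Equiv.Perm.mul_apply]
    rw [hφπ _ g'.2, hφπ _ g.2, ← Subgroup.coe_mul, hφπ _ (g * g').2]
    rfl
  · obtain ⟨σ, hσ, h⟩ := h2 τ τ.2
    refine ⟨⟨σ, hσ⟩, Subtype.ext (uniq _ _ fun x => ?_)⟩
    exact (hφπ σ hσ x).trans (h x).symm

/-- The permutations that preserve the fibres of a map with `m` fibres of `n` points. -/
theorem exists_hom_range_eq_fiberPreserving [Finite Ω] [Finite Λ] {m n : ℕ}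
    (hm : Nat.card Λ = m) (hn : ∀ l, Nat.card {x // π x = l} = n) :
    ∃ ι : (Fin m → Equiv.Perm (Fin n)) →* Equiv.Perm Ω, Function.Injective ι ∧
      ∀ σ, σ ∈ ι.range ↔ ∀ x, π (σ x) = π x := by
  subst hm
  let e₁ : Λ ≃ Fin (Nat.card Λ) := Finite.equivFin Λ
  let e₂ : ∀ l, {x // π x = l} ≃ Fin n := fun l => Finite.equivFinOfCardEq (hn l)
  -- In these coordinates `π` is the first projection.
  let e : Ω ≃ Fin (Nat.card Λ) × Fin n :=
    ((Equiv.sigmaFiberEquiv π).symm.trans (Equiv.sigmaCongrRight e₂)).trans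
      ((Equiv.sigmaEquivProd _ _).trans (e₁.prodCongr (Equiv.refl _)))
  have he : ∀ x, (e x).1 = e₁ (π x) := fun x => rfl
  let ι : (Fin (Nat.card Λ) → Equiv.Perm (Fin n)) →* Equiv.Perm Ω :=
    MonoidHom.mk' (fun s => e.symm.permCongr (Equiv.prodCongrRight s)) fun s s' => by
      ext x
      simp only [Equiv.permCongr_apply, Equiv.Perm.mul_apply, Equiv.symm_symm,
        Equiv.apply_symm_apply]
      rfl
  have hι : ∀ s x, e (ι s x) = ((e x).1, s (e x).1 (e x).2) := by
    intro s x
    exact e.apply_symm_apply _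
  refine ⟨ι, fun s s' h => ?_, fun σ => ⟨?_, fun hσ => ?_⟩⟩
  · funext i
    ext j : 1
    have := congrArg e (congrArg (fun τ : Equiv.Perm Ω => τ (e.symm (i, j))) h)
    simp only [hι, Equiv.apply_symm_apply] at this
    exact congrArg Prod.snd this
  · rintro ⟨s, rfl⟩ x
    apply e₁.injective
    rw [← he, ← he, hι]
  · have h1 : ∀ i j, (e (σ (e.symm (i, j)))).1 = i := by
      intro i j
      rw [he, hσ, ← he, Equiv.apply_symm_apply]
    have h2 : ∀ i j, (e (σ.symm (e.symm (i, j)))).1 = i := by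
      intro i j
      rw [he, ← hσ, Equiv.apply_symm_apply, ← he, Equiv.apply_symm_apply]
    refine ⟨fun i => ⟨fun j => (e (σ (e.symm (i, j)))).2, fun j => (e (σ.symm (e.symm (i, j)))).2,
      fun j => ?_, fun j => ?_⟩, ?_⟩
    · have : (i, (e (σ (e.symm (i, j)))).2) = e (σ (e.symm (i, j))) := Prod.ext (h1 i j).symm rfl
      simp [this]
    · have : (i, (e (σ.symm (e.symm (i, j)))).2) = e (σ.symm (e.symm (i, j))) :=
        Prod.ext (h2 i j).symm rfl
      simp [this]
    · ext x : 1
      apply e.injective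
      rw [hι]
      refine Prod.ext ?_ ?_
      · simp [he, hσ]
      · simp

end FiberedPermutations

end CurveCover

namespace CurveCover

open Set Filter

/-! ### The transposition around a simple branch point -/

section LocalMonodromy

variable {X Y : Type*} [TopologicalSpace X] [ChartedSpace ℂ X] [IsManifold 𝓘(ℂ) ω X]
  [TopologicalSpace Y] [ChartedSpace ℂ Y] [IsManifold 𝓘(ℂ) ω Y] {f : X → Y}

omit [IsManifold 𝓘(ℂ) ω X] [IsManifold 𝓘(ℂ) ω Y] in
theorem IsSimplyBranched.ramificationIndex_ne_top (hf : IsSimplyBranched f) (x : X) :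
    ramificationIndex f x ≠ ⊤ := by
  intro h
  have := hf.index_le_two x
  rw [h] at this
  exact absurd this (by simp)

theorem IsSimplyBranched.ramificationIndex_eq_two (hf : IsSimplyBranched f) {x : X}
    (hx : ramificationIndex f x ≠ 1) : ramificationIndex f x = 2 := by
  have h1 := hf.index_le_two x
  have h0 := ramificationIndex_ne_zero hf.holomorphic x
  have ht := hf.ramificationIndex_ne_top x
  cases h : ramificationIndex f x with
  | top => exact absurd h ht
  | coe n =>
    rw [h] at h1 h0 hx
    norm_cast at h1 h0 hx ⊢
    lia

/-- A small loop around a branch point of a simply branched cover interchanges two points near the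
ramification point, and fixes all other points of the fibre. -/
theorem IsSimplyBranched.exists_loop_swap (hf : IsSimplyBranched f) {x₀ : X}
    (hx₀ : ramificationIndex f x₀ ≠ 1) {W : Set X} (hW : W ∈ 𝓝 x₀) :
    ∃ y ∉ branchLocus f, ∃ γ : Path y y, (∀ t, γ t ∉ branchLocus f) ∧
      ∃ a ∈ W, ∃ a' ∈ W, a ≠ a' ∧ f a = y ∧ f a' = y ∧
        (∃ Γ : Path a a', ∀ t, f (Γ t) = γ t) ∧ (∃ Γ : Path a' a, ∀ t, f (Γ t) = γ t) ∧
        ∀ x, f x = y → x ≠ a → x ≠ a' → ∃ Γ : Path x x, ∀ t, f (Γ t) = γ t := by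
  obtain ⟨u, hxu, hux, hu⟩ := exists_coordinate_sq hf.holomorphic (hf.ramificationIndex_eq_two hx₀)
  set c' := chartAt ℂ (f x₀)
  -- the other points of the fibre
  have hφ : ∀ x : X, ∃ φ : OpenPartialHomeomorph X Y, f x = f x₀ → x ≠ x₀ →
      x ∈ φ.source ∧ EqOn f φ φ.source := by
    intro x
    by_cases h : f x = f x₀ ∧ x ≠ x₀
    · have h1 : ramificationIndex f x = 1 := by
        by_contra h2
        exact h.2 (hf.unique_ramification x x₀ h.1 h2 hx₀)
      obtain ⟨φ, hφ⟩ := exists_openPartialHomeomorph hf.holomorphic h1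
      exact ⟨φ, fun _ _ => hφ⟩
    -- A dummy value, never used.
    · exact ⟨(u.trans c'.symm), fun h1 h2 => absurd ⟨h1, h2⟩ h⟩
  choose φ hφ using hφ
  classical
  obtain ⟨T, hTf, hT⟩ := (hf.proper.isCompact_preimage (isCompact_singleton (x := f x₀))).elim_nhds_subcover
    (fun x => if x = x₀ then u.source else (φ x).source) (by
      intro x hx
      split_ifs with h
      · rw [h]
        exact u.open_source.mem_nhds hxu
      · exact (φ x).open_source.mem_nhds (hφ x hx h).1)
  -- a neighbourhood of the branch point
  have hV : ∀ᶠ z in 𝓝 (f x₀), (∀ x, f x = z → ∃ t ∈ T, x ∈ if t = x₀ then u.source else (φ t).source) ∧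
      (∀ t ∈ T, t ≠ x₀ → z ∈ (φ t).target) ∧ (z ≠ f x₀ → z ∉ branchLocus f) := by
    refine Eventually.and ?_ (Eventually.and ?_ ?_)
    -- Since `f` is closed, the fibres near that of `f x₀` stay inside the chosen finite cover of
    -- it.
    · have hO : IsOpen (⋃ t ∈ T, if t = x₀ then u.source else (φ t).source) := by
        refine isOpen_biUnion fun t _ => ?_
        split_ifs
        exacts [u.open_source, (φ t).open_source]
      have h1 : f x₀ ∈ (f '' (⋃ t ∈ T, if t = x₀ then u.source else (φ t).source)ᶜ)ᶜ := by
        rintro ⟨x, hx, h⟩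
        exact hx (hT h)
      filter_upwards [(hf.proper.isClosedMap _ hO.isClosed_compl).isOpen_compl.mem_nhds h1]
        with z hz x hx
      by_contra h2
      refine hz ⟨x, fun h3 => h2 ?_, hx⟩
      simpa using h3
    · refine (T.eventually_all).2 fun t ht => ?_
      by_cases h : t = x₀
      · exact Eventually.of_forall fun z h' => absurd h h'
      · obtain ⟨h1, h2⟩ := hφ t (hTf t ht) h
        have h3 : f x₀ ∈ (φ t).target := by
          rw [← show f t = f x₀ from hTf t ht, h2 h1]
          exact (φ t).map_source h1
        filter_upwards [(φ t).open_target.mem_nhds h3] with z hz _ using hz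
    · exact eventually_nhdsWithin_iff.1
        (eventually_notMem_branchLocus hf.toIsCover hf.ramificationIndex_ne_top _)
  have hu0 : (0 : ℂ) ∈ u.target := by
    rw [← hux]
    exact u.map_source hxu
  have hus0 : u.symm 0 = x₀ := by
    rw [← hux]
    exact u.left_inv hxu
  have hcont : ContinuousAt u.symm 0 := u.continuousAt_symm hu0
  obtain ⟨V, hV, hVP⟩ := hV.exists_mem
  have hfu : ContinuousAt (f ∘ u.symm) 0 := hf.holomorphic.continuous.continuousAt.comp hcont
  have hw : ∀ᶠ w in 𝓝 (0 : ℂ), w ∈ u.target ∧ u.symm w ∈ W ∧ f (u.symm w) ∈ V := by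
    filter_upwards [u.open_target.mem_nhds hu0, hcont (by rwa [hus0]),
      hfu (show V ∈ 𝓝 ((f ∘ u.symm) 0) by simpa [hus0] using hV)] with w h1 h2 h3
    exact ⟨h1, h2, h3⟩
  obtain ⟨ε, hε, hball⟩ := Metric.eventually_nhds_iff.1 hw
  have hsq : ∀ w ∈ u.target, f (u.symm w) ∈ c'.source ∧ c' (f (u.symm w)) = c' (f x₀) + w ^ 2 := by
    intro w hw
    have := hu _ (u.map_target hw)
    rwa [u.right_inv hw] at this
  set ρ : ℂ := ((ε / 2 : ℝ) : ℂ)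
  have hρ0 : ρ ≠ 0 := by simp [ρ, hε.ne']
  -- A half circle from `ρ` to `-ρ` in the coordinate `u`. Squaring makes it a full circle around
  -- the branch point, whose lifts near `x₀` are given by `w` and `-w`; they exchange the two
  -- points.
  let w : unitInterval → ℂ := fun t => ρ * Complex.exp (Real.pi * Complex.I * (t : ℝ))
  have hwc : Continuous w := by fun_prop
  have hw0 : w 0 = ρ := by simp [w]
  have hw1 : w 1 = -ρ := by simp [w]
  have hwn : ∀ t, ‖w t‖ = ε / 2 := by
    intro t
    have : (Real.pi * Complex.I * (t : ℝ) : ℂ) = ((Real.pi * (t : ℝ) : ℝ) : ℂ) * Complex.I := by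
      push_cast; ring
    rw [norm_mul, this, Complex.norm_exp_ofReal_mul_I]
    simp [ρ, abs_of_pos hε]
  have hwne : ∀ t, w t ≠ 0 := fun t h => by
    have := hwn t
    rw [h, norm_zero] at this
    linarith
  have hwb : ∀ t, dist (w t) 0 < ε := fun t => by rw [dist_zero_right, hwn]; linarith
  have hwb' : ∀ t, dist (-w t) 0 < ε := fun t => by rw [dist_zero_right, norm_neg, hwn]; linarith
  have hneg : ∀ t, f (u.symm (-w t)) = f (u.symm (w t)) := by
    intro t
    obtain ⟨h1, h2⟩ := hsq _ (hball (hwb t)).1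
    obtain ⟨h3, h4⟩ := hsq _ (hball (hwb' t)).1
    refine c'.injOn h3 h1 ?_
    rw [h2, h4, neg_sq]
  have hbr : ∀ t, f (u.symm (w t)) ∉ branchLocus f := by
    intro t
    refine (hVP _ (hball (hwb t)).2.2).2.2 fun h => ?_
    have := (hsq _ (hball (hwb t)).1).2
    rw [h] at this
    exact hwne t (by simpa using this)
  have hc1 : Continuous fun t => u.symm (w t) :=
    u.continuousOn_symm.comp_continuous hwc fun t => (hball (hwb t)).1
  have hc2 : Continuous fun t => u.symm (-w t) :=
    u.continuousOn_symm.comp_continuous hwc.neg fun t => (hball (hwb' t)).1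
  have hρρ : f (u.symm (-ρ)) = f (u.symm ρ) := by
    rw [← hw0]
    exact hneg 0
  refine ⟨f (u.symm ρ), hw0 ▸ hbr 0, ⟨⟨fun t => f (u.symm (w t)),
    hf.holomorphic.continuous.comp hc1⟩, ?_, ?_⟩, hbr, u.symm ρ, ?_, u.symm (-ρ), ?_, ?_, rfl, hρρ,
    ⟨⟨⟨_, hc1⟩, ?_, ?_⟩, fun t => rfl⟩, ⟨⟨⟨_, hc2⟩, ?_, ?_⟩, hneg⟩, ?_⟩
  · simp [hw0]
  · simp [hw1, hρρ]
  · rw [← hw0]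
    exact (hball (hwb 0)).2.1
  · rw [← hw0]
    exact (hball (hwb' 0)).2.1
  · intro h
    have h1 := hw0 ▸ (hball (hwb 0)).1
    have h2 := hw0 ▸ (hball (hwb' 0)).1
    have := u.symm.injOn h1 h2 h
    exact hρ0 (by simpa [self_eq_neg] using this)
  · simp [hw0]
  · simp [hw1]
  · simp [hw0]
  · simp [hw1]
  · intro x hx hxa hxa'
    have hb0 := hball (hwb 0)
    rw [hw0] at hb0
    obtain ⟨t, htT, ht⟩ := (hVP _ hb0.2.2).1 x hx
    split_ifs at ht with h
    -- A point of the fibre in the domain of `u` has coordinate `ρ` or `-ρ`.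
    · exfalso
      obtain ⟨-, h1⟩ := hu x ht
      obtain ⟨-, h2⟩ := hsq ρ hb0.1
      rw [hx, h2] at h1
      rcases sq_eq_sq_iff_eq_or_eq_neg.1 (add_left_cancel h1) with h3 | h3
      · exact hxa (by rw [h3, u.left_inv ht])
      · exact hxa' (by rw [h3, neg_neg, u.left_inv ht])
    -- The loop stays in the target of the local inverse of `f` at `t`, which lifts it to a closed
    -- loop.
    · have hmem : ∀ s, f (u.symm (w s)) ∈ (φ t).target := fun s => (hVP _ (hball (hwb s)).2.2).2.1 t htT h
      have heq := (hφ t (hTf t htT) h).2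
      have hxφ : (φ t).symm (f (u.symm ρ)) = x := by
        rw [← hx, heq ht, (φ t).left_inv ht]
      refine ⟨⟨⟨fun s => (φ t).symm (f (u.symm (w s))), (φ t).continuousOn_symm.comp_continuous
        (hf.holomorphic.continuous.comp hc1) hmem⟩, ?_, ?_⟩, fun s => ?_⟩
      · simp [hw0, hxφ]
      · simp [hw1, hρρ, hxφ]
      · exact (heq ((φ t).map_target (hmem s))).trans ((φ t).right_inv (hmem s))

end LocalMonodromy

end CurveCover

namespace CurveCover

open Set Filter

/-! ### Monodromy of the composite cover -/

section Composition

variable {C Dbar D : Type*}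
  [TopologicalSpace C] [ChartedSpace ℂ C] [IsManifold 𝓘(ℂ) ω C]
  [TopologicalSpace Dbar] [ChartedSpace ℂ Dbar] [IsManifold 𝓘(ℂ) ω Dbar]
  [TopologicalSpace D] [ChartedSpace ℂ D] [IsManifold 𝓘(ℂ) ω D]
  {q : C → Dbar} {h : Dbar → D}

theorem ramificationIndex_eq_one_of_comp (hq : MDifferentiable 𝓘(ℂ) 𝓘(ℂ) q)
    (hh : MDifferentiable 𝓘(ℂ) 𝓘(ℂ) h) {x : C} (hx : ramificationIndex (h ∘ q) x = 1) :
    ramificationIndex q x = 1 := by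
  rw [ramificationIndex_eq_one_iff (hh.comp hq)] at hx
  rw [ramificationIndex_eq_one_iff hq]
  intro h0
  apply hx
  rw [mfderiv_comp x (hh _) (hq x), h0, ContinuousLinearMap.comp_zero]

theorem branchLocus_subset_preimage (hq : MDifferentiable 𝓘(ℂ) 𝓘(ℂ) q)
    (hh : MDifferentiable 𝓘(ℂ) 𝓘(ℂ) h) : branchLocus q ⊆ h ⁻¹' branchLocus (h ∘ q) := by
  rintro _ ⟨x, hx, rfl⟩
  exact ⟨x, fun h1 => hx (ramificationIndex_eq_one_of_comp hq hh h1), rfl⟩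

theorem eventually_notMem_preimage (hh : MDifferentiable 𝓘(ℂ) 𝓘(ℂ) h) (hunr : IsUnramified h)
    {B : Set D} (hB : ∀ y, ∀ᶠ z in 𝓝[≠] y, z ∉ B) (p : Dbar) :
    ∀ᶠ z in 𝓝[≠] p, z ∉ h ⁻¹' B := by
  obtain ⟨φ, hφ, he⟩ := exists_openPartialHomeomorph hh (hunr p)
  have h1 : Tendsto h (𝓝[≠] p) (𝓝[≠] (h p)) := by
    refine tendsto_nhdsWithin_iff.2 ⟨hh.continuous.continuousAt.mono_left nhdsWithin_le_nhds, ?_⟩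
    rw [eventually_nhdsWithin_iff]
    filter_upwards [φ.open_source.mem_nhds hφ] with z hz hne heq
    exact hne (φ.injOn hz hφ (by rw [← he hz, ← he hφ]; exact heq))
  exact h1.eventually (hB (h p))

-- Openness passes from `h ∘ q` to `q` by composing with a local inverse of `h`; it makes `q`
-- surjective.
omit [ChartedSpace ℂ C] [IsManifold 𝓘(ℂ) ω C] in
theorem nhds_le_map_nhds_of_comp (hq : Continuous q) (hh : MDifferentiable 𝓘(ℂ) 𝓘(ℂ) h)
    (hunr : IsUnramified h) {x : C} (hx : 𝓝 ((h ∘ q) x) ≤ map (h ∘ q) (𝓝 x)) :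
    𝓝 (q x) ≤ map q (𝓝 x) := by
  obtain ⟨φ, hφ, he⟩ := exists_openPartialHomeomorph hh (hunr (q x))
  have h1 : ∀ l : Filter Dbar, l ≤ 𝓝 (q x) → map φ.symm (map h l) = l := by
    intro l hl
    rw [map_map]
    conv_rhs => rw [← map_id (f := l)]
    refine Filter.map_congr ?_
    filter_upwards [hl (φ.open_source.mem_nhds hφ)] with z hz
    rw [Function.comp_apply, he hz, φ.left_inv hz, id]
  have h2 : map h (𝓝 (q x)) ≤ map h (map q (𝓝 x)) :=
    hh.continuous.continuousAt.trans (by rwa [map_map])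
  have h3 := map_mono (m := φ.symm) h2
  rwa [h1 _ le_rfl, h1 _ hq.continuousAt] at h3

variable [T2Space C]

omit [IsManifold 𝓘(ℂ) ω Dbar] in
/-- Lifts of a path along `q` are lifts of its image in `D` along `h ∘ q`; hence a path between two
points of a fibre of `h` has a monodromy permutation. -/
theorem exists_mem_monodromyGroup_of_path (hh : IsCover h)
    (hf : IsCover (h ∘ q)) {y : D} (hy : y ∈ (branchLocus (h ∘ q))ᶜ) {p p' : Dbar} (η : Path p p')
    (hη : ∀ t, h (η t) ∉ branchLocus (h ∘ q)) (hp : h p = y) (hp' : h p' = y) :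
    ∃ g ∈ monodromyGroup hf ⟨y, hy⟩, ∀ x x', ∀ (hx : (h ∘ q) x = y), ∀ Γ : Path x x',
      (∀ t, q (Γ t) = η t) → (g ⟨x, hx⟩ : C) = x' := by
  obtain ⟨g, hg, hgl⟩ := exists_mem_monodromyGroup hf hy
    ((η.map hh.holomorphic.continuous).cast hp.symm hp'.symm) hη
  refine ⟨g, hg, fun x x' hx Γ hΓ => ?_⟩
  obtain ⟨Γ', hΓ'⟩ := hgl ⟨x, hx⟩
  exact lift_path_unique hf.isCoveringMapOn _ hη Γ' Γ hΓ' fun t => congrArg h (hΓ t)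

variable [T2Space Dbar]

/-- The monodromy group of a simply branched cover with a branch point contains a transposition of
two points with the same image in the unramified part. -/
theorem exists_swap_mem_monodromyGroup [ConnectedSpace D] (hq : IsCover q) (hh : IsCover h)
    (hf : IsSimplyBranched (h ∘ q)) (hunr : IsUnramified h)
    (hbranch : (branchLocus (h ∘ q)).Nonempty) {y : D} (hy : y ∈ (branchLocus (h ∘ q))ᶜ)
    [DecidableEq ((h ∘ q) ⁻¹' {y})] :
    ∃ a a' : (h ∘ q) ⁻¹' {y}, a ≠ a' ∧ q a = q a' ∧
      Equiv.swap a a' ∈ monodromyGroup hf.toIsCover ⟨y, hy⟩ := by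
  obtain ⟨-, x₀, hx₀, rfl⟩ := hbranch
  obtain ⟨φ, hφ, he⟩ := exists_openPartialHomeomorph hh.holomorphic (hunr (q x₀))
  obtain ⟨z, hz, γ, hγ, a, haW, a', haW', hne, ha, ha', ⟨Γ, hΓ⟩, ⟨Γ', hΓ'⟩, hfix⟩ :=
    hf.exists_loop_swap hx₀ (hq.holomorphic.continuous.continuousAt.preimage_mem_nhds
      (φ.open_source.mem_nhds hφ))
  have hqa : q a = q a' := by
    refine φ.injOn haW haW' ?_
    rw [← he haW, ← he haW']
    exact ha.trans ha'.symm
  obtain ⟨δ, hδ⟩ := exists_path_avoiding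
    (eventually_notMem_branchLocus hf.toIsCover hf.ramificationIndex_ne_top) hz hy
  have hc := hf.toIsCover.isCoveringMapOn
  obtain ⟨b, Δ, hΔ⟩ := exists_lift_path hc δ hδ ha
  obtain ⟨b', Δ', hΔ'⟩ := exists_lift_path hc δ hδ ha'
  have hb : (h ∘ q) b = y := by simpa using hΔ 1
  have hb' : (h ∘ q) b' = y := by simpa using hΔ' 1
  have trans_mem : ∀ {u v w : D} (p : Path u v) (p' : Path v w), (∀ t, p t ∉ branchLocus (h ∘ q)) →
      (∀ t, p' t ∉ branchLocus (h ∘ q)) → ∀ t, p.trans p' t ∉ branchLocus (h ∘ q) := by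
    intro u v w p p' hp hp' t
    rw [Path.trans_apply]
    split_ifs
    exacts [hp _, hp' _]
  have trans_lift : ∀ {u v w : D} {u' v' w' : C} (p : Path u v) (p' : Path v w) (P : Path u' v')
      (P' : Path v' w'), (∀ t, (h ∘ q) (P t) = p t) → (∀ t, (h ∘ q) (P' t) = p' t) →
      ∀ t, (h ∘ q) (P.trans P' t) = p.trans p' t := by
    intro u v w u' v' w' p p' P P' hP hP' t
    rw [Path.trans_apply, Path.trans_apply]
    split_ifs
    exacts [hP _, hP' _]
  have hℓ : ∀ t, (δ.symm.trans γ).trans δ t ∉ branchLocus (h ∘ q) :=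
    trans_mem _ _ (trans_mem _ _ (fun t => hδ _) hγ) hδ
  refine ⟨⟨b, hb⟩, ⟨b', hb'⟩, fun h' => hne ?_, ?_, ?_⟩
  · exact lift_path_unique hc δ.symm (fun t => hδ _) Δ.symm
      (Δ'.symm.cast (congrArg Subtype.val h') rfl) (fun t => hΔ _) fun t => hΔ' _
  -- The images of `Δ` and `Δ'` under `q` lift `δ` along `h` from the same point.
  · exact lift_path_unique hh.isCoveringMapOn δ (fun t => hunr.mem_compl_branchLocus _)
      (Δ.map hq.holomorphic.continuous) ((Δ'.map hq.holomorphic.continuous).cast hqa rfl) hΔ hΔ'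
  · refine mem_monodromyGroup_of_loop hf.toIsCover hy ((δ.symm.trans γ).trans δ) hℓ fun x => ?_
    by_cases hxb : x = ⟨b, hb⟩
    · rw [hxb, Equiv.swap_apply_left]
      exact ⟨(Δ.symm.trans Γ).trans Δ', trans_lift _ _ _ _
        (trans_lift _ _ _ _ (fun t => hΔ _) hΓ) hΔ'⟩
    by_cases hxb' : x = ⟨b', hb'⟩
    · rw [hxb', Equiv.swap_apply_right]
      exact ⟨(Δ'.symm.trans Γ').trans Δ, trans_lift _ _ _ _
        (trans_lift _ _ _ _ (fun t => hΔ' _) hΓ') hΔ⟩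
    rw [Equiv.swap_apply_of_ne_of_ne hxb hxb']
    obtain ⟨c, E, hE⟩ := exists_lift_path hc δ.symm (fun t => hδ _) x.2
    have hcz : (h ∘ q) c = z := by simpa using hE 1
    have hE' : ∀ t, (h ∘ q) (E.symm t) = δ t := fun t => by simpa using hE (unitInterval.symm t)
    obtain ⟨Φ, hΦ⟩ := hfix c hcz
      (fun hca => hxb (Subtype.ext (lift_path_unique hc δ hδ (E.symm.cast hca.symm rfl) Δ hE' hΔ)))
      (fun hca => hxb' (Subtype.ext
        (lift_path_unique hc δ hδ (E.symm.cast hca.symm rfl) Δ' hE' hΔ')))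
    exact ⟨(E.trans Φ).trans E.symm, trans_lift _ _ _ _ (trans_lift _ _ _ _ hE hΦ) hE'⟩

omit [T2Space Dbar] in
/-- If `q` has full monodromy, the monodromy group of `h ∘ q` acts transitively on the pairs of
distinct points with the same image under `q`. -/
theorem exists_mem_monodromyGroup_pair [ConnectedSpace Dbar] (hq : IsCover q) (hh : IsCover h)
    (hf : IsSimplyBranched (h ∘ q)) (hfull : HasFullMonodromy hq) (hunr : IsUnramified h)
    {y : D} (hy : y ∈ (branchLocus (h ∘ q))ᶜ) {a a' b b' : (h ∘ q) ⁻¹' {y}} (ha : a ≠ a')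
    (hqa : q a = q a') (hb : b ≠ b') (hqb : q b = q b') :
    ∃ g ∈ monodromyGroup hf.toIsCover ⟨y, hy⟩, g a = b ∧ g a' = b' := by
  classical
  -- Paths in `Dbar` must avoid all of `B`, not only the branch points of `q`, for their images in
  -- `D` to act on the fibre of `h ∘ q`.
  set B := h ⁻¹' branchLocus (h ∘ q)
  have hB : ∀ p, ∀ᶠ z in 𝓝[≠] p, z ∉ B := eventually_notMem_preimage hh.holomorphic hunr
    (eventually_notMem_branchLocus hf.toIsCover hf.ramificationIndex_ne_top)
  have hsub : branchLocus q ⊆ B := branchLocus_subset_preimage hq.holomorphic hh.holomorphic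
  have hBq : ∀ p, ∀ᶠ z in 𝓝[≠] p, z ∉ branchLocus q := fun p => by
    filter_upwards [hB p] with z hz h' using hz (hsub h')
  have hyB : ∀ x : (h ∘ q) ⁻¹' {y}, q x ∉ B := fun x hx => hy (by
    have : (h ∘ q) x = y := x.2
    rw [← this]
    exact hx)
  have hc := hq.isCoveringMapOn
  obtain ⟨η, hη⟩ := exists_path_avoiding hB (hyB a) (hyB b)
  obtain ⟨e, E, hE⟩ := exists_lift_path hc η (fun t ht => hη t (hsub ht)) rfl
  obtain ⟨e', E', hE'⟩ := exists_lift_path hc η (fun t ht => hη t (hsub ht)) hqa.symm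
  have he : q e = q b := by simpa using hE 1
  have he' : q e' = q b := by simpa using hE' 1
  have hne : e ≠ e' := by
    rintro rfl
    exact ha (Subtype.ext (lift_path_unique hc η.symm (fun t ht => hη _ (hsub ht)) E.symm E'.symm
      (fun t => hE _) fun t => hE' _))
  -- a permutation of the fibre of `q` that maps `e` to `b` and `e'` to `b'`
  obtain ⟨s, hs, hs'⟩ : ∃ s : Equiv.Perm (q ⁻¹' {q b}), s ⟨e, he⟩ = ⟨b, rfl⟩ ∧
      s ⟨e', he'⟩ = ⟨b', hqb.symm⟩ := by
    have h2 : ∀ i j k l : q ⁻¹' {q (b : C)}, i ≠ j → k ≠ l →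
        ∃ s : Equiv.Perm (q ⁻¹' {q (b : C)}), s i = k ∧ s j = l := fun _ _ _ _ =>
      MulAction.is_two_pretransitive_iff.1 (Equiv.Perm.isMultiplyPretransitive _ 2)
    exact h2 ⟨e, he⟩ ⟨e', he'⟩ ⟨b, rfl⟩ ⟨b', hqb.symm⟩
      (fun h' => hne (congrArg Subtype.val h'))
      (fun h' => hb (Subtype.ext (Subtype.mk.inj h')))
  -- Full monodromy realises `s` by a loop, which is then moved off the larger set `B`. The path `η`
  -- followed by `β` carries `(a, a')` to `(b, b')`.
  obtain ⟨β, -, hβB, hβ⟩ := exists_loop_of_mem_monodromyGroup hq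
    (isClosed_of_eventually_notMem hBq) hB (y := q b) (fun h' => hyB b (hsub h')) (hyB b)
    (σ := s) (hfull ⟨q b, _⟩ s)
  obtain ⟨Γ, hΓ⟩ := hβ ⟨e, he⟩
  obtain ⟨Γ', hΓ'⟩ := hβ ⟨e', he'⟩
  have trans_lift : ∀ {u v : C} (P : Path u v) {w : C} (P' : Path v w), (∀ t, q (P t) = η t) →
      (∀ t, q (P' t) = β t) → ∀ t, q (P.trans P' t) = η.trans β t := by
    intro u v P w P' hP hP' t
    rw [Path.trans_apply, Path.trans_apply]
    split_ifs
    exacts [hP _, hP' _]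
  have hηβ : ∀ t, h (η.trans β t) ∉ branchLocus (h ∘ q) := by
    intro t
    rw [Path.trans_apply]
    split_ifs
    exacts [hη _, hβB _]
  obtain ⟨g, hg, hgl⟩ := exists_mem_monodromyGroup_of_path hh hf.toIsCover hy (η.trans β) hηβ
    a.2 b.2
  refine ⟨g, hg, Subtype.ext ?_, Subtype.ext ?_⟩
  · exact hgl a b a.2 (E.trans (Γ.cast rfl (congrArg Subtype.val hs.symm))) (trans_lift _ _ hE hΓ)
  · exact hgl a' b' a'.2 (E'.trans (Γ'.cast rfl (congrArg Subtype.val hs'.symm)))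
      (trans_lift _ _ hE' hΓ')

end Composition

end CurveCover

/-! ### The exact sequence -/

theorem mainTheorem11 {C Dbar D : Type*}
    [TopologicalSpace C] [T2Space C] [ConnectedSpace C]
    [ChartedSpace ℂ C] [IsManifold 𝓘(ℂ) ω C]
    [TopologicalSpace Dbar] [T2Space Dbar] [ConnectedSpace Dbar]
    [ChartedSpace ℂ Dbar] [IsManifold 𝓘(ℂ) ω Dbar]
    [TopologicalSpace D] [T2Space D] [ConnectedSpace D]
    [ChartedSpace ℂ D] [IsManifold 𝓘(ℂ) ω D]
    (q : C → Dbar) (h : Dbar → D)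
    (hq : CurveCover.IsCover q) (hh : CurveCover.IsCover h)
    (hf : CurveCover.IsSimplyBranched (h ∘ q))
    (hfull : CurveCover.HasFullMonodromy hq)
    (hunr : CurveCover.IsUnramified h)
    (hbranch : (CurveCover.branchLocus (h ∘ q)).Nonempty ∨ CurveCover.degree q = 1)
    (y : D) (hy : y ∈ (CurveCover.branchLocus (h ∘ q))ᶜ) :
    ∃ (ι : (Fin (CurveCover.degree h) → Equiv.Perm (Fin (CurveCover.degree q))) →*
          CurveCover.monodromyGroup hf.toIsCover ⟨y, hy⟩)
      (ψ : CurveCover.monodromyGroup hf.toIsCover ⟨y, hy⟩ →*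
          CurveCover.monodromyGroup hh ⟨y, hunr.mem_compl_branchLocus y⟩),
      -- the sequence `1 → S_d̃ × ⋯ × S_d̃ → G → Ḡ → 1` is exact
      Function.Injective ι ∧ ι.range = ψ.ker ∧ Function.Surjective ψ ∧
      -- `ψ` is the natural map: `g` acts on the fibre of `h` through `ψ g`
      (∀ g (x : (h ∘ q) ⁻¹' {y}) (p : h ⁻¹' {y}), (p : Dbar) = q x →
        ((ψ g : Equiv.Perm (h ⁻¹' {y})) p : Dbar) =
          q ((g : Equiv.Perm ((h ∘ q) ⁻¹' {y})) x)) ∧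
      -- its kernel consists of all permutations that preserve each fibre of `q`
      (∀ σ : Equiv.Perm ((h ∘ q) ⁻¹' {y}),
        (∃ hσ : σ ∈ CurveCover.monodromyGroup hf.toIsCover ⟨y, hy⟩, ψ ⟨σ, hσ⟩ = 1) ↔
          ∀ x, q (σ x) = q x) := by
  classical
  set B := CurveCover.branchLocus (h ∘ q)
  have hBdisc : ∀ z, ∀ᶠ w in 𝓝[≠] z, w ∉ B :=
    CurveCover.eventually_notMem_branchLocus hf.toIsCover hf.ramificationIndex_ne_top
  have hsub : CurveCover.branchLocus q ⊆ h ⁻¹' B :=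
    CurveCover.branchLocus_subset_preimage hq.holomorphic hh.holomorphic
  have hqB : ∀ p, h p = y → p ∉ CurveCover.branchLocus q := fun p hp hpq =>
    hy (by rw [← hp]; exact hsub hpq)
  have hqdisc : ∀ p, ∀ᶠ w in 𝓝[≠] p, w ∉ CurveCover.branchLocus q := fun p => by
    filter_upwards [CurveCover.eventually_notMem_preimage hh.holomorphic hunr hBdisc p]
      with w hw hw' using hw (hsub hw')
  have hhdisc : ∀ z, ∀ᶠ w in 𝓝[≠] z, w ∉ CurveCover.branchLocus h := fun z =>
    Filter.Eventually.of_forall hunr.mem_compl_branchLocus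
  have hqsurj : Function.Surjective q := hq.surjective fun x =>
    CurveCover.nhds_le_map_nhds_of_comp hq.holomorphic.continuous hh.holomorphic hunr
      (CurveCover.nhds_le_map_nhds hf.holomorphic (hf.ramificationIndex_ne_top x))
  let π : (h ∘ q) ⁻¹' {y} → h ⁻¹' {y} := fun x => ⟨q x, x.2⟩
  have hπ : Function.Surjective π := by
    rintro ⟨p, hp⟩
    obtain ⟨x, rfl⟩ := hqsurj p
    exact ⟨⟨x, hp⟩, rfl⟩
  have hπ_iff : ∀ x x', π x = π x' ↔ q x = q x' := fun x x' => Subtype.ext_iff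
  have hΩ : Finite ((h ∘ q) ⁻¹' {y}) := CurveCover.finite_fiber hf.toIsCover hy
  have hΛ : Finite (h ⁻¹' {y}) := CurveCover.finite_fiber hh (hunr.mem_compl_branchLocus y)
  have hcardΛ : Nat.card (h ⁻¹' {y}) = CurveCover.degree h :=
    (CurveCover.degree_eq_ncard_fiber hh hhdisc (hunr.mem_compl_branchLocus y)).symm
  have hcard : ∀ p : h ⁻¹' {y}, Nat.card {x // π x = p} = CurveCover.degree q := by
    intro p
    rw [CurveCover.degree_eq_ncard_fiber hq hqdisc (hqB p p.2)]
    refine Nat.card_congr ⟨fun x => ⟨x.1.1, congrArg Subtype.val x.2⟩,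
      fun x => ⟨⟨x.1, ?_⟩, Subtype.ext x.2⟩, fun x => rfl, fun x => rfl⟩
    have h1 : q x.1 = p := x.2
    rw [Set.mem_preimage, Function.comp_apply, h1]
    exact p.2
  -- all permutations that preserve the fibres of `q` are monodromy permutations
  have hN : ∀ σ : Equiv.Perm ((h ∘ q) ⁻¹' {y}), (∀ x, π (σ x) = π x) →
      σ ∈ CurveCover.monodromyGroup hf.toIsCover ⟨y, hy⟩ := by
    intro σ hσ
    rcases hbranch with hbranch | hdeg
    · obtain ⟨a, a', hne, hqa, hswap⟩ :=
        CurveCover.exists_swap_mem_monodromyGroup hq hh hf hunr hbranch hy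
      refine CurveCover.mem_of_forall_fiber_eq (π := π) hswap (fun b b' hb hqb => ?_) hσ
      exact CurveCover.exists_mem_monodromyGroup_pair hq hh hf hfull hunr hy hne hqa hb
        ((hπ_iff b b').1 hqb)
    -- In degree one each fibre of `π` is a single point.
    · have h1 : σ = 1 := by
        ext x : 1
        have h2 := hcard (π x)
        rw [hdeg, Nat.card_eq_one_iff_unique] at h2
        obtain ⟨h2, -⟩ := h2
        exact congrArg Subtype.val (Subsingleton.elim (⟨σ x, hσ x⟩ : {z // π z = π x}) ⟨x, rfl⟩)
      rw [h1]
      exact Subgroup.one_mem _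
  obtain ⟨ψ, hψ, hψπ⟩ := CurveCover.exists_hom_of_compatible (π := π)
    (G := CurveCover.monodromyGroup hf.toIsCover ⟨y, hy⟩)
    (H := CurveCover.monodromyGroup hh ⟨y, hunr.mem_compl_branchLocus y⟩) hπ
    (by
      intro σ hσ
      obtain ⟨γ, hγ, -, hγσ⟩ := CurveCover.exists_loop_of_mem_monodromyGroup hf.toIsCover
        (CurveCover.isClosed_of_eventually_notMem hBdisc) hBdisc hy hy hσ
      obtain ⟨τ, hτ, hγτ⟩ := CurveCover.exists_mem_monodromyGroup hh
        (hunr.mem_compl_branchLocus y) γ fun t => hunr.mem_compl_branchLocus _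
      refine ⟨τ, hτ, fun x => Subtype.ext ?_⟩
      obtain ⟨Γ, hΓ⟩ := hγσ x
      obtain ⟨Γ', hΓ'⟩ := hγτ (π x)
      exact CurveCover.lift_path_unique hh.isCoveringMapOn γ
        (fun t => hunr.mem_compl_branchLocus _) Γ' (Γ.map hq.holomorphic.continuous) hΓ' hΓ)
    (by
      intro τ hτ
      -- The loop for `h` is moved off the branch points of `h ∘ q`, so it has a monodromy
      -- permutation there too.
      obtain ⟨γ, -, hγ, hγτ⟩ := CurveCover.exists_loop_of_mem_monodromyGroup hh
        (CurveCover.isClosed_of_eventually_notMem hhdisc) hBdisc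
        (hunr.mem_compl_branchLocus y) hy hτ
      obtain ⟨σ, hσ, hγσ⟩ := CurveCover.exists_mem_monodromyGroup hf.toIsCover hy γ hγ
      refine ⟨σ, hσ, fun x => Subtype.ext ?_⟩
      obtain ⟨Γ, hΓ⟩ := hγσ x
      obtain ⟨Γ', hΓ'⟩ := hγτ (π x)
      exact CurveCover.lift_path_unique hh.isCoveringMapOn γ
        (fun t => hunr.mem_compl_branchLocus _) Γ' (Γ.map hq.holomorphic.continuous) hΓ' hΓ)
  have hker : ∀ g, ψ g = 1 ↔ ∀ x, π ((g : Equiv.Perm ((h ∘ q) ⁻¹' {y})) x) = π x := by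
    intro g
    constructor
    · intro hg x
      rw [← hψπ, hg]
      rfl
    · intro hg
      ext p
      obtain ⟨x, rfl⟩ := hπ p
      exact congrArg Subtype.val ((hψπ g x).trans (hg x))
  obtain ⟨ι, hι, hιr⟩ := CurveCover.exists_hom_range_eq_fiberPreserving (π := π) hcardΛ hcard
  refine ⟨ι.codRestrict _ fun s => hN _ ((hιr _).1 ⟨s, rfl⟩), ψ, ?_, ?_, hψ, ?_, ?_⟩
  · intro s s' hs
    exact hι (congrArg Subtype.val hs)
  · ext g
    rw [MonoidHom.mem_ker, hker, ← hιr]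
    constructor
    · rintro ⟨s, rfl⟩
      exact ⟨s, rfl⟩
    · rintro ⟨s, hs⟩
      exact ⟨s, Subtype.ext hs⟩
  · intro g x p hp
    obtain rfl : p = π x := Subtype.ext hp
    exact congrArg Subtype.val (hψπ g x)
  · intro σ
    constructor
    · rintro ⟨hσ, h1⟩ x
      exact (hπ_iff _ _).1 ((hker _).1 h1 x)
    · intro hσ
      have h1 : ∀ x, π (σ x) = π x := fun x => (hπ_iff _ _).2 (hσ x)
      exact ⟨hN σ h1, (hker _).2 h1⟩
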